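/- Let $\pi:Y\to X$ be a smooth fiber bundle, $J^rY$ the jet manifolds of its sections, $J^\infty Y=\varprojlim J^rY$, and let $\mathcal O_\infty Y=\varinjlim C^\infty(J^rY)$. Let $E\to X$ be a smooth vector bundle of finite rank and let $\mathcal S_\infty[E;Y]=\varinjlim_r \mathcal A_{E_r}$, where $\mathcal A_{E_r}$ is the ring of smooth sections of the exterior bundle of the dual of $E_r=J^rY\times_XJ^rE$ over $J^rY$. As an algebra over $\mathcal O_\infty Y$ it is locally generated by the odd elements $c^a_\Lambda$ (the linear jet coordinates on the fibers of $J^rE$, $0\le|\Lambda|\le r$, $\Lambda$ a symmetric multi-index), and it is graded, $\mathcal S_\infty[E;Y]=\bigoplus_{k\ge0}\mathcal S_\infty[E;Y]_k$ with $\mathcal S_\infty[E;Y]_0=\mathcal O_\infty Y$, by the degree $k$ in the $c^a_\Lambda$. Let $\mathcal E$ be an $E$-valued differential operator of order $q$ on $Y$, i.e., a smooth bundle morphism $J^qY\to E$ over $X$, with local components $\mathcal E^a$. Then there is a unique $\mathcal O_\infty Y$-linear map $\delta=\overset{\leftarrow}{\partial}_a\mathcal E^a$ of $\mathcal S_\infty[E;Y]$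 to itself that acts pointwise on $J^\infty Y$, as a right antiderivation of the Grassmann algebra at each point, and satisfies, in every local basis, $\delta(c^a_\Lambda)=d_\Lambda\mathcal E^a$, where $d_\Lambda$ are the iterated total derivatives. It vanishes on $\mathcal O_\infty Y$, obeys $\delta(f f')=(-1)^{[f']}\delta(f)f'+f\,\delta(f')$, and is nilpotent, $\delta\circ\delta=0$. Hence $$0\leftarrow \mathcal O_\infty Y\xleftarrow{\ \delta\ }\mathcal S_\infty[E;Y]_1\xleftarrow{\ \delta\ }\cdots\xleftarrow{\ \delta\ }\mathcal S_\infty[E;Y]_k\xleftarrow{\ \delta\ }\cdots$$ is a chain complex of $\mathcal O_\infty Y$-modules. Its boundaries vanish on $\operatorname{Ker}\mathcal E$ in the following sense: if $\Phi\in\mathcal S_\infty[E;Y]$ involves only the $c^a_\Lambda$ with $|\Lambda|\le k$, then $\delta\Phi$ vanishes at every point of $J^\infty Y$ that lies over the $k$-th prolongation $\{j^{q+k}_xs : j^k_x(\mathcal E\circ j^qs)=0\}$ of $\operatorname{Ker}\mathcal E=\{j\in J^qY:\mathcal E(j)=0\}$ (for $k=0$, over $\operatorname{Ker}\mathcal E$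 itself). In particular, every boundary vanishes at the infinite jets of all local sections $s$ of $Y$ with $\mathcal E\circ j^qs=0$. -/

import Mathlib

open scoped Manifold ContDiff Topology
open Bundle CategoryTheory

noncomputable section

namespace KoszulTate

/-! ### Multi-indices and partial derivatives -/

/-- The coordinate space `ℝⁿ`. -/
abbrev Euc (n : ℕ) := EuclideanSpace ℝ (Fin n)

/-- Symmetric multi-indices `Λ = (λ₁ ... λₖ)`; `|Λ|` is `Multiset.card Λ`, and `λ + Λ` is
`λ ::ₘ Λ`. -/
abbrev MultiIndex (n : ℕ) := Multiset (Fin n)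

/-- Multi-indices with `|Λ| ≤ r`. -/
abbrev MultiIndexLE (n r : ℕ) := {L : MultiIndex n // Multiset.card L ≤ r}

instance (n r : ℕ) : Finite (MultiIndexLE n r) := by
  let f : (Σ k : Fin (r + 1), Sym (Fin n) k) → MultiIndexLE n r :=
    fun p => ⟨p.2.1, by have h := p.2.2; have := p.1.2; omega⟩
  refine Finite.of_surjective f ?_
  rintro ⟨L, hL⟩
  exact ⟨⟨⟨Multiset.card L, by omega⟩, ⟨L, rfl⟩⟩, rfl⟩

instance (n r : ℕ) : Fintype (MultiIndexLE n r) := Fintype.ofFinite _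

/-- The partial derivative `∂_λ` on functions on `ℝⁿ`. -/
def partialD {n : ℕ} (i : Fin n) (g : Euc n → ℝ) : Euc n → ℝ :=
  fun p => fderiv ℝ g p (EuclideanSpace.single i 1)

/-- The iterated partial derivative `∂_Λ = ∂_{λ₁} ∘ ⋯ ∘ ∂_{λₖ}`. -/
def iterD {n : ℕ} (L : MultiIndex n) (g : Euc n → ℝ) : Euc n → ℝ :=
  L.toList.foldr partialD g

section helpers

variable {n : ℕ} {f g : Euc n → ℝ} {p : Euc n}

theorem partialD_smooth (i : Fin n) (hf : ∀ᶠ q in 𝓝 p, ContDiffAt ℝ ∞ f q) :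
    ∀ᶠ q in 𝓝 p, ContDiffAt ℝ ∞ (partialD i f) q := by
  filter_upwards [hf] with q hq
  exact (hq.fderiv_right (m := ∞) (by simp)).clm_apply contDiffAt_const

theorem foldr_smooth (l : List (Fin n)) (hf : ∀ᶠ q in 𝓝 p, ContDiffAt ℝ ∞ f q) :
    ∀ᶠ q in 𝓝 p, ContDiffAt ℝ ∞ (l.foldr partialD f) q := by
  induction l with
  | nil => exact hf
  | cons i l ih => exact partialD_smooth i ih

theorem partialD_congr (i : Fin n) (h : f =ᶠ[𝓝 p] g) : partialD i f =ᶠ[𝓝 p] partialD i g := by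
  filter_upwards [h.fderiv (𝕜 := ℝ)] with q hq
  simp [partialD, hq]

theorem foldr_add (l : List (Fin n)) (hf : ∀ᶠ q in 𝓝 p, ContDiffAt ℝ ∞ f q)
    (hg : ∀ᶠ q in 𝓝 p, ContDiffAt ℝ ∞ g q) :
    l.foldr partialD (f + g) =ᶠ[𝓝 p] l.foldr partialD f + l.foldr partialD g := by
  induction l with
  | nil => exact Filter.EventuallyEq.rfl
  | cons i l ih =>
    refine (partialD_congr i ih).trans ?_
    filter_upwards [foldr_smooth l hf, foldr_smooth l hg] with q h1 h2
    simp [partialD, fderiv_add (h1.differentiableAt (by simp)) (h2.differentiableAt (by simp))]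

theorem foldr_smul (l : List (Fin n)) (a : ℝ) (hf : ∀ᶠ q in 𝓝 p, ContDiffAt ℝ ∞ f q) :
    l.foldr partialD (a • f) =ᶠ[𝓝 p] a • l.foldr partialD f := by
  induction l with
  | nil => exact Filter.EventuallyEq.rfl
  | cons i l ih =>
    refine (partialD_congr i ih).trans ?_
    filter_upwards [foldr_smooth l hf] with q h1
    simp [partialD, fderiv_const_smul (h1.differentiableAt (by simp))]

end helpers

/-! ### Jet coordinates and total derivatives -/

/-- Coordinates `(x^λ, y^i_Λ)`, `0 ≤ |Λ|`, on the infinite order jet manifold. -/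
abbrev InfCoord (n m : ℕ) := Euc n × (Fin m → MultiIndex n → ℝ)

/-- Coordinates `(x^λ, y^i_Λ)`, `0 ≤ |Λ| ≤ r`, on the `r`-order jet manifold. -/
abbrev FinCoord (n m r : ℕ) := Euc n × (Fin m → MultiIndexLE n r → ℝ)

/-- The projection to jet coordinates of order at most `r`. -/
def trunc {n m : ℕ} (r : ℕ) (p : InfCoord n m) : FinCoord n m r := (p.1, fun i L => p.2 i L.1)

/-- The projection from jet coordinates of order at most `r'` to those of order at most `r`. -/
def restr {n m r r' : ℕ} (h : r ≤ r') : FinCoord n m r' →L[ℝ] FinCoord n m r :=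
  (ContinuousLinearMap.fst ℝ _ _).prod (ContinuousLinearMap.pi fun i =>
    ContinuousLinearMap.pi fun L : MultiIndexLE n r =>
      (ContinuousLinearMap.proj (R := ℝ) (φ := fun _ : MultiIndexLE n r' => ℝ)
        ⟨L.1, L.2.trans h⟩).comp
        ((ContinuousLinearMap.proj (R := ℝ) (φ := fun _ : Fin m => MultiIndexLE n r' → ℝ) i).comp
          (ContinuousLinearMap.snd ℝ _ _)))

/-- The total derivative `d_λ = ∂_λ + ∑ y^i_{λ+Λ} ∂_i^Λ`, that is, the derivative along the vector
with components `(δ^μ_λ, y^i_{λ+Λ})`; it is applied to functions that depend smoothly on finitely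
many jet coordinates only. -/
def totalD {n m : ℕ} (i : Fin n) (g : InfCoord n m → ℝ) : InfCoord n m → ℝ :=
  fun p => lineDeriv ℝ g p (EuclideanSpace.single i 1, fun j L => p.2 j (i ::ₘ L))

/-- `d_Λ = d_{λ₁} ∘ ⋯ ∘ d_{λₖ}`. -/
def iterTotalD {n m : ℕ} (L : MultiIndex n) (g : InfCoord n m → ℝ) : InfCoord n m → ℝ :=
  L.toList.foldr totalD g

/-! ### Smooth fiber bundles, bundle charts and jets of sections -/

section Bundle

variable (n m : ℕ)
  {X : Type*} [TopologicalSpace X] [ChartedSpace (Euc n) X]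
  {Y : Type*} [TopologicalSpace Y] [ChartedSpace (ModelProd (Euc n) (Euc m)) Y]

/-- `pr : Y → X` is a smooth fiber bundle with typical fiber `V`: it is smooth and locally
diffeomorphic over `X` to the product with `V`. -/
structure IsSmoothFiberBundle (V : Type*) [TopologicalSpace V] [ChartedSpace (Euc m) V]
    (pr : Y → X) : Prop where
  smooth_proj : ContMDiff ((𝓡 n).prod (𝓡 m)) (𝓡 n) ∞ pr
  locally_trivial : ∀ x : X, ∃ e : Trivialization V pr, x ∈ e.baseSet ∧
    ContMDiffOn ((𝓡 n).prod (𝓡 m)) ((𝓡 n).prod (𝓡 m)) ∞ e e.source ∧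
    ContMDiffOn ((𝓡 n).prod (𝓡 m)) ((𝓡 n).prod (𝓡 m)) ∞ e.toOpenPartialHomeomorph.symm e.target

variable (X) in
/-- A smooth coordinate chart `(x^λ)` of `X`. -/
structure BaseChart where
  u : OpenPartialHomeomorph X (Euc n)
  smooth : ContMDiffOn (𝓡 n) (𝓡 n) ∞ u u.source
  smooth_symm : ContMDiffOn (𝓡 n) (𝓡 n) ∞ u.symm u.target

/-- A smooth bundle coordinate chart `(U_Y; x^λ, y^i)` of `Y → X`. -/
structure BundleChart (pr : Y → X) extends BaseChart n X where
  v : OpenPartialHomeomorph Y (Euc n × Euc m)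
  smooth_v : ContMDiffOn ((𝓡 n).prod (𝓡 m)) ((𝓡 n).prod (𝓡 m)) ∞ v v.source
  smooth_v_symm : ContMDiffOn ((𝓡 n).prod (𝓡 m)) ((𝓡 n).prod (𝓡 m)) ∞ v.symm v.target
  proj_mem : ∀ y ∈ v.source, pr y ∈ u.source
  proj_eq : ∀ y ∈ v.source, (v y).1 = u (pr y)

/-- `s` is a smooth section of `pr` on a neighbourhood of `x`. -/
def IsLocalSection (pr : Y → X) (s : X → Y) (x : X) : Prop :=
  ∀ᶠ x' in 𝓝 x, ContMDiffAt (𝓡 n) ((𝓡 n).prod (𝓡 m)) ∞ s x' ∧ pr (s x') = x'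

/-- A point of `X` with a smooth section of `Y → X` defined near this point
(the values of `toFun` away from the point are irrelevant). -/
structure LocalSection (pr : Y → X) where
  base : X
  toFun : X → Y
  isLocalSection : IsLocalSection n m pr toFun base

variable {n m}

/-- The jet coordinate `y^i_Λ = ∂_Λ (y^i ∘ s)` at the base point of a local section. -/
def jetCoord {pr : Y → X} (β : BundleChart n m pr)
    (s : LocalSection n m pr) (i : Fin m) (L : MultiIndex n) : ℝ :=
  iterD L (fun p => (β.v (s.toFun (β.u.symm p))).2 i) (β.u s.base)

variable (n m) in
/-- Two local sections have the same `r`-jet: same base point, same value, and same partial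
derivatives up to order `r` in bundle coordinates. -/
def jetSetoid (pr : Y → X) (r : ℕ) : Setoid (LocalSection n m pr) where
  r s t := s.base = t.base ∧ s.toFun s.base = t.toFun t.base ∧
    ∀ β : BundleChart n m pr, s.toFun s.base ∈ β.v.source →
      ∀ (i : Fin m) (L : MultiIndex n), Multiset.card L ≤ r → jetCoord β s i L = jetCoord β t i L
  iseqv :=
    { refl := fun _ => ⟨rfl, rfl, fun _ _ _ _ _ => rfl⟩
      symm := fun h => ⟨h.1.symm, h.2.1.symm,
        fun β hβ i L hL => (h.2.2 β (h.2.1 ▸ hβ) i L hL).symm⟩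
      trans := fun h h' => ⟨h.1.trans h'.1, h.2.1.trans h'.2.1,
        fun β hβ i L hL => (h.2.2 β hβ i L hL).trans (h'.2.2 β (h.2.1 ▸ hβ) i L hL)⟩ }

variable (n m) in
/-- The `r`-order jet manifold `J^r Y` (as a set; its smooth functions are described below in the
bundle coordinates). -/
def Jet (pr : Y → X) (r : ℕ) := Quotient (jetSetoid n m pr r)

namespace Jet

variable {pr : Y → X} {r : ℕ}

/-- The `r`-jet of a local section at its base point. -/
def mk (r : ℕ) (s : LocalSection n m pr) : Jet n m pr r :=
  Quotient.mk (jetSetoid n m pr r) s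

/-- The projection `J^r Y → X`. -/
def base (j : Jet n m pr r) : X :=
  Quotient.lift (s := jetSetoid n m pr r) LocalSection.base (fun _ _ h => h.1) j

/-- The projection `J^r Y → Y`. -/
def value (j : Jet n m pr r) : Y :=
  Quotient.lift (s := jetSetoid n m pr r) (fun s => s.toFun s.base) (fun _ _ h => h.2.1) j

/-- The projection `J^{r+1} Y → J^r Y`. -/
def proj (j : Jet n m pr (r + 1)) : Jet n m pr r :=
  Quotient.lift (s := jetSetoid n m pr (r + 1)) (mk r) (fun _ _ h => Quotient.sound
    ⟨h.1, h.2.1, fun β hβ i L hL => h.2.2 β hβ i L (by omega)⟩) j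

/-- Some local section that represents the jet. -/
def rep (j : Jet n m pr r) : LocalSection n m pr :=
  Quotient.out (s := jetSetoid n m pr r) j

/-- The coordinates `(x^λ, y^i_Λ)`, `|Λ| ≤ r`, of an `r`-jet whose value lies in the chart
(they do not depend on the representative). -/
def coord (β : BundleChart n m pr) (j : Jet n m pr r) :
    FinCoord n m r :=
  (β.u j.base, fun i L => jetCoord β j.rep i L.1)

end Jet

variable (n m) in
/-- The infinite order jet manifold `J^∞ Y`, the projective limit of the `J^r Y`. -/
def InfJet (pr : Y → X) :=
  {z : ∀ r, Jet n m pr r // ∀ r, (z (r + 1)).proj = z r}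

namespace InfJet

variable {pr : Y → X}

/-- The projection `J^∞ Y → X`. -/
def base (z : InfJet n m pr) : X := (z.1 0).base

/-- The projection `J^∞ Y → Y`. -/
def value (z : InfJet n m pr) : Y := (z.1 0).value

/-- The infinite order jet of a local section at its base point. -/
def mk (s : LocalSection n m pr) : InfJet n m pr :=
  ⟨fun r => Jet.mk r s, fun _ => rfl⟩

/-- The coordinates `(x^λ, y^i_Λ)` of an infinite order jet whose value lies in the chart. -/
def coord (β : BundleChart n m pr) (z : InfJet n m pr) :
    InfCoord n m :=
  (β.u z.base, fun i L => jetCoord β (z.1 (Multiset.card L)).rep i L)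

end InfJet

/-- `f` is (the pull-back of) a smooth function on `J^r Y`. -/
def IsSmoothFunction {pr : Y → X} (r : ℕ) (f : InfJet n m pr → ℝ) : Prop :=
  ∀ (β : BundleChart n m pr) (z₀ : InfJet n m pr),
    z₀.value ∈ β.v.source →
    ∃ (O : Set (FinCoord n m r)) (G : FinCoord n m r → ℝ),
      IsOpen O ∧ trunc r (z₀.coord β) ∈ O ∧ ContDiffOn ℝ ∞ G O ∧
      ∀ z : InfJet n m pr, z.value ∈ β.v.source → trunc r (z.coord β) ∈ O →
        f z = G (trunc r (z.coord β))

namespace IsSmoothFunction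

variable {pr : Y → X} {r r' : ℕ} {f g : InfJet n m pr → ℝ}

theorem mono (h : r ≤ r') (hf : IsSmoothFunction r f) : IsSmoothFunction r' f := by
  intro β z₀ hz₀
  obtain ⟨O, G, hO, hz, hG, hfG⟩ := hf β z₀ hz₀
  exact ⟨restr h ⁻¹' O, G ∘ restr h, hO.preimage (restr h).continuous, hz,
    hG.comp (restr h).contDiff.contDiffOn (fun _ hp => hp), hfG⟩

theorem mul (hf : IsSmoothFunction r f) (hg : IsSmoothFunction r g) :
    IsSmoothFunction r (f * g) := by
  intro β z₀ hz₀
  obtain ⟨O, G, hO, hz, hG, hfG⟩ := hf β z₀ hz₀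
  obtain ⟨O', G', hO', hz', hG', hfG'⟩ := hg β z₀ hz₀
  refine ⟨O ∩ O', G * G', hO.inter hO', ⟨hz, hz'⟩,
    (hG.mono Set.inter_subset_left).mul (hG'.mono Set.inter_subset_right), fun z h1 h2 => ?_⟩
  rw [Pi.mul_apply, Pi.mul_apply, hfG z h1 h2.1, hfG' z h1 h2.2]

theorem add (hf : IsSmoothFunction r f) (hg : IsSmoothFunction r g) :
    IsSmoothFunction r (f + g) := by
  intro β z₀ hz₀
  obtain ⟨O, G, hO, hz, hG, hfG⟩ := hf β z₀ hz₀
  obtain ⟨O', G', hO', hz', hG', hfG'⟩ := hg β z₀ hz₀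
  refine ⟨O ∩ O', G + G', hO.inter hO', ⟨hz, hz'⟩,
    (hG.mono Set.inter_subset_left).add (hG'.mono Set.inter_subset_right), fun z h1 h2 => ?_⟩
  rw [Pi.add_apply, Pi.add_apply, hfG z h1 h2.1, hfG' z h1 h2.2]

end IsSmoothFunction

variable (n m) in
/-- The ring `O_∞ Y` of smooth real functions on finite order jet manifolds modulo the pull-back
identification, realized as a ring of functions on `J^∞ Y`. -/
def OInf (pr : Y → X) : Subalgebra ℝ (InfJet n m pr → ℝ) where
  carrier := {f | ∃ r, IsSmoothFunction r f}
  mul_mem' := by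
    rintro f g ⟨r, hf⟩ ⟨r', hg⟩
    exact ⟨max r r', (hf.mono (le_max_left _ _)).mul (hg.mono (le_max_right _ _))⟩
  add_mem' := by
    rintro f g ⟨r, hf⟩ ⟨r', hg⟩
    exact ⟨max r r', (hf.mono (le_max_left _ _)).add (hg.mono (le_max_right _ _))⟩
  algebraMap_mem' := fun a => ⟨0, fun _ _ _ => ⟨Set.univ, fun _ => a, isOpen_univ, trivial,
    contDiffOn_const, fun _ _ _ => rfl⟩⟩

end Bundle

/-! ### Vector bundles, their jets and graded functions -/

section VectorBundle

set_option linter.unusedSectionVars false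

variable {n m l : ℕ}
  {X : Type*} [TopologicalSpace X] [ChartedSpace (Euc n) X]
  (E : X → Type*) [∀ x, AddCommGroup (E x)] [∀ x, Module ℝ (E x)]
  [TopologicalSpace (TotalSpace (Euc l) E)] [∀ x, TopologicalSpace (E x)]
  [FiberBundle (Euc l) E]

variable (n l) in
/-- A smooth linear local trivialization of `E → X`; the components of the fiber coordinate are the
local fiber basis `{c^a}` of the dual bundle `E^*`. -/
structure FrameChart where
  e : Trivialization (Euc l) (π (Euc l) E)
  isLinear : e.IsLinear ℝ
  smooth : ContMDiffOn ((𝓡 n).prod 𝓘(ℝ, Euc l)) ((𝓡 n).prod 𝓘(ℝ, Euc l)) ∞ e e.source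
  smooth_symm : ContMDiffOn ((𝓡 n).prod 𝓘(ℝ, Euc l)) ((𝓡 n).prod 𝓘(ℝ, Euc l)) ∞
    e.toOpenPartialHomeomorph.symm e.target

variable [VectorBundle ℝ (Euc l) E] [IsManifold (𝓡 n) ∞ X] [ContMDiffVectorBundle ∞ (Euc l) E (𝓡 n)]

variable (n l) in
/-- The vector space of (germs of) smooth sections of `E` near `x`. -/
def SecE (x : X) : Submodule ℝ (∀ x, E x) where
  carrier := {s | ∀ᶠ x' in 𝓝 x, ContMDiffAt (𝓡 n) ((𝓡 n).prod 𝓘(ℝ, Euc l)) ∞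
    (fun y => TotalSpace.mk' (Euc l) y (s y)) x'}
  add_mem' := by
    intro s t hs ht
    filter_upwards [hs, ht] with x' h1 h2
    exact h1.add_section h2
  zero_mem' := Filter.Eventually.of_forall fun x' => contMDiffAt_zeroSection ℝ E
  smul_mem' := by
    intro a s hs
    filter_upwards [hs] with x' h1
    exact ContMDiffAt.smul_section contMDiffAt_const h1

variable {E}

/-- The components `∂_Λ (e^a ∘ s)` at `x` of the jet of a section `s` of `E`. -/
def secCoord (u : BaseChart n X) (e : FrameChart n l E) (a : Fin l) (L : MultiIndex n) (x : X)
    (s : ∀ x, E x) : ℝ :=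
  iterD L (fun p => (e.e ⟨u.u.symm p, s (u.u.symm p)⟩).2 a) (u.u x)

theorem secCoord_smooth (u : BaseChart n X) (e : FrameChart n l E) (a : Fin l) {x : X}
    (hu : x ∈ u.u.source) (he : x ∈ e.e.baseSet) {s : ∀ x, E x} (hs : s ∈ SecE n l E x) :
    ∀ᶠ p in 𝓝 (u.u x), ContDiffAt ℝ ∞
      (fun p => (e.e ⟨u.u.symm p, s (u.u.symm p)⟩).2 a) p := by
  have h0 : Filter.Tendsto u.u.symm (𝓝 (u.u x)) (𝓝 x) := by
    have := u.u.continuousAt_symm (u.u.map_source hu)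
    rwa [ContinuousAt, u.u.left_inv hu] at this
  have h1 := h0.eventually hs
  have h2 := h0.eventually (e.e.open_baseSet.mem_nhds he)
  have h3 := u.u.open_target.mem_nhds (u.u.map_source hu)
  filter_upwards [h1, h2, h3] with p hp1 hp2 hp3
  have k1 : ContMDiffAt (𝓡 n) (𝓡 n) ∞ u.u.symm p :=
    u.smooth_symm.contMDiffAt (u.u.open_target.mem_nhds hp3)
  have k2 : ContMDiffAt ((𝓡 n).prod 𝓘(ℝ, Euc l)) ((𝓡 n).prod 𝓘(ℝ, Euc l)) ∞ e.e
      (TotalSpace.mk' (Euc l) (u.u.symm p) (s (u.u.symm p))) :=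
    e.smooth.contMDiffAt (e.e.open_source.mem_nhds (e.e.mem_source.2 hp2))
  have k3 : ContMDiffAt (𝓡 n) ((𝓡 n).prod 𝓘(ℝ, Euc l)) ∞
      (fun p => e.e (TotalSpace.mk' (Euc l) (u.u.symm p) (s (u.u.symm p)))) p :=
    ContMDiffAt.comp (g := e.e)
      (f := fun p => TotalSpace.mk' (Euc l) (u.u.symm p) (s (u.u.symm p))) p k2
      (ContMDiffAt.comp (g := fun y => TotalSpace.mk' (Euc l) y (s y)) p hp1 k1)
  have k4 : ContDiffAt ℝ ∞ (fun p => (e.e ⟨u.u.symm p, s (u.u.symm p)⟩).2) p :=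
    k3.snd.contDiffAt
  exact (contDiffAt_piLp_apply (p := 2) (i := a)).comp p k4

theorem foldr_congr {n : ℕ} {f g : Euc n → ℝ} {p : Euc n} (L : List (Fin n)) (h : f =ᶠ[𝓝 p] g) :
    L.foldr partialD f =ᶠ[𝓝 p] L.foldr partialD g := by
  induction L with
  | nil => exact h
  | cons i L ih => exact partialD_congr i ih

theorem symm_mem_baseSet (u : BaseChart n X) (e : FrameChart n l E) {x : X}
    (hu : x ∈ u.u.source) (he : x ∈ e.e.baseSet) :
    ∀ᶠ p in 𝓝 (u.u x), u.u.symm p ∈ e.e.baseSet := by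
  have h0 := u.u.continuousAt_symm (u.u.map_source hu)
  rw [ContinuousAt, u.u.left_inv hu] at h0
  exact h0.eventually (e.e.open_baseSet.mem_nhds he)

/-- `secCoord` as a linear functional on the space of germs of sections. -/
def secCoordLin (u : BaseChart n X) (e : FrameChart n l E) (a : Fin l) (L : MultiIndex n) (x : X)
    (hu : x ∈ u.u.source) (he : x ∈ e.e.baseSet) : SecE n l E x →ₗ[ℝ] ℝ where
  toFun s := secCoord u e a L x s.1
  map_add' := by
    intro s t
    have h := (foldr_add L.toList (secCoord_smooth u e a hu he s.2)
      (secCoord_smooth u e a hu he t.2)).eq_of_nhds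
    refine Eq.trans (foldr_congr L.toList ?_).eq_of_nhds h
    filter_upwards [symm_mem_baseSet u e hu he] with p hp
    have := (e.isLinear.linear _ hp).map_add (s.1 (u.u.symm p)) (t.1 (u.u.symm p))
    exact congrArg (fun w : Euc l => w a) this
  map_smul' := by
    intro c s
    have h := (foldr_smul L.toList c (secCoord_smooth u e a hu he s.2)).eq_of_nhds
    refine Eq.trans (foldr_congr L.toList ?_).eq_of_nhds h
    filter_upwards [symm_mem_baseSet u e hu he] with p hp
    have := (e.isLinear.linear _ hp).map_smul c (s.1 (u.u.symm p))
    exact congrArg (fun w : Euc l => w a) this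

variable (n l E) in
/-- The germs of sections of `E` at `x` with vanishing `k`-jet. -/
def jetVanish (x : X) (k : ℕ) : Submodule ℝ (SecE n l E x) :=
  ⨅ (u : BaseChart n X) (e : FrameChart n l E) (hu : x ∈ u.u.source) (he : x ∈ e.e.baseSet)
    (a : Fin l) (L : MultiIndexLE n k), LinearMap.ker (secCoordLin u e a L.1 x hu he)

theorem mem_jetVanish {x : X} {k : ℕ} {s : SecE n l E x} :
    s ∈ jetVanish n l E x k ↔ ∀ (u : BaseChart n X) (e : FrameChart n l E),
      x ∈ u.u.source → x ∈ e.e.baseSet → ∀ (a : Fin l) (L : MultiIndex n),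
        Multiset.card L ≤ k → secCoord u e a L x s.1 = 0 := by
  simp only [jetVanish, Submodule.mem_iInf, LinearMap.mem_ker]
  exact ⟨fun h u e hu he a L hL => h u e hu he a ⟨L, hL⟩,
    fun h u e hu he a L => h u e hu he a L.1 L.2⟩

theorem jetVanish_succ_le (x : X) (k : ℕ) : jetVanish n l E x (k + 1) ≤ jetVanish n l E x k := by
  intro s hs
  rw [mem_jetVanish] at hs ⊢
  exact fun u e hu he a L hL => hs u e hu he a L (by omega)

variable (n l E) in
/-- The fiber `J^k_x E` of the jet bundle `J^k E → X`. -/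
abbrev JetE (x : X) (k : ℕ) := SecE n l E x ⧸ jetVanish n l E x k

variable (n l E) in
/-- The fiber `J^∞_x E`, the projective limit of the `J^k_x E`. -/
def InfJetE (x : X) : Submodule ℝ (∀ k, JetE n l E x k) where
  carrier := {v | ∀ k, Submodule.factor (jetVanish_succ_le x k) (v (k + 1)) = v k}
  add_mem' := fun hv hw k => by simp [hv k, hw k]
  zero_mem' := fun k => by simp
  smul_mem' := fun c v hv k => by simp [hv k]

/-- The element `c^a_Λ` of the local fiber basis: the functional on `J^∞_x E` (it factors through
`J^k_x E` for `k = |Λ|`) that sends a jet of a section `s` to `∂_Λ (e^a ∘ s)`. -/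
def fiberCoord (u : BaseChart n X) (e : FrameChart n l E) (a : Fin l) (L : MultiIndex n) (x : X)
    (hu : x ∈ u.u.source) (he : x ∈ e.e.baseSet) : Module.Dual ℝ (InfJetE n l E x) :=
  (((jetVanish n l E x (Multiset.card L)).liftQ (secCoordLin u e a L x hu he) (fun _ hs =>
    mem_jetVanish.1 hs u e hu he a L le_rfl)).comp (LinearMap.proj (Multiset.card L))).comp
    (InfJetE n l E x).subtype

variable {Y : Type*} [TopologicalSpace Y] [ChartedSpace (ModelProd (Euc n) (Euc m)) Y]

variable (n l E) in
/-- The Grassmann algebra at a point `z` of `J^∞ Y` over `x`: the exterior algebra of the dual of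
`J^∞_x E`. -/
abbrev Grassmann {pr : Y → X} (z : InfJet n m pr) :=
  ExteriorAlgebra ℝ (Module.Dual ℝ (InfJetE n l E z.base))

/-- The point `z` lies over the domain of the local basis `(y^i_Λ, c^a_Λ)` given by the bundle
chart `β` and the trivialization `e`. -/
structure InDomain {pr : Y → X} (β : BundleChart n m pr) (e : FrameChart n l E)
    (z : InfJet n m pr) : Prop where
  value_mem : z.value ∈ β.v.source
  base_mem : z.base ∈ β.u.source
  frame_mem : z.base ∈ e.e.baseSet

/-- The odd element `c^a_Λ` at the point `z`. -/
def oddCoord {pr : Y → X} (β : BundleChart n m pr) (e : FrameChart n l E) {z : InfJet n m pr}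
    (hz : InDomain β e z) (p : Fin l × MultiIndex n) : Grassmann n l E z :=
  ExteriorAlgebra.ι ℝ
    (fiberCoord β.toBaseChart e p.1 p.2 z.base hz.base_mem hz.frame_mem)

/-- `F` is a graded function with coefficients of jet order `r` in the jets of order `k` of the odd
elements: locally it is a finite sum of monomials `G c^{a₁}_{Λ₁} ⋯ c^{aₛ}_{Λₛ}` with smooth functions
`G` on `J^r Y` and `|Λᵢ| ≤ k`. For `k = r` this means that `F` is (the pull-back of) a smooth
section of the exterior bundle of the dual of `E_r = J^r Y × J^r E` over `J^r Y`. -/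
def IsGradedFunction {pr : Y → X} (r k : ℕ) (F : ∀ z : InfJet n m pr, Grassmann n l E z) : Prop :=
  ∀ (β : BundleChart n m pr) (e : FrameChart n l E) (z₀ : InfJet n m pr), InDomain β e z₀ →
    ∃ (O : Set (FinCoord n m r)) (I : Type) (_ : Fintype I) (w : I → List (Fin l × MultiIndex n))
      (G : I → FinCoord n m r → ℝ),
      IsOpen O ∧ trunc r (z₀.coord β) ∈ O ∧
      (∀ i, ContDiffOn ℝ ∞ (G i) O ∧ ∀ p ∈ w i, Multiset.card p.2 ≤ k) ∧
      ∀ (z : InfJet n m pr) (hz : InDomain β e z), trunc r (z.coord β) ∈ O →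
        F z = ∑ i, G i (trunc r (z.coord β)) • ((w i).map (oddCoord β e hz)).prod

namespace IsGradedFunction

variable {pr : Y → X} {r r' k k' : ℕ} {F F' : ∀ z : InfJet n m pr, Grassmann n l E z}

theorem mono (h : r ≤ r') (hk : k ≤ k') (hF : IsGradedFunction r k F) :
    IsGradedFunction r' k' F := by
  intro β e z₀ hz₀
  obtain ⟨O, I, _, w, G, hO, hz, hG, hFG⟩ := hF β e z₀ hz₀
  exact ⟨restr h ⁻¹' O, I, inferInstance, w, fun i => G i ∘ restr h,
    hO.preimage (restr h).continuous, hz,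
    fun i => ⟨(hG i).1.comp (restr h).contDiff.contDiffOn (fun _ hp => hp),
      fun p hp => ((hG i).2 p hp).trans hk⟩, hFG⟩

theorem add (hF : IsGradedFunction r k F) (hF' : IsGradedFunction r k F') :
    IsGradedFunction r k (F + F') := by
  intro β e z₀ hz₀
  obtain ⟨O, I, _, w, G, hO, hz, hG, hFG⟩ := hF β e z₀ hz₀
  obtain ⟨O', I', _, w', G', hO', hz', hG', hFG'⟩ := hF' β e z₀ hz₀
  refine ⟨O ∩ O', I ⊕ I', inferInstance, Sum.elim w w', Sum.elim G G', hO.inter hO', ⟨hz, hz'⟩,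
    ?_, fun z h1 h2 => ?_⟩
  · rintro (i | i)
    · exact ⟨(hG i).1.mono Set.inter_subset_left, (hG i).2⟩
    · exact ⟨(hG' i).1.mono Set.inter_subset_right, (hG' i).2⟩
  · rw [Pi.add_apply, hFG z h1 h2.1, hFG' z h1 h2.2, Fintype.sum_sum_type]
    rfl

theorem mul (hF : IsGradedFunction r k F) (hF' : IsGradedFunction r k F') :
    IsGradedFunction r k (F * F') := by
  intro β e z₀ hz₀
  obtain ⟨O, I, _, w, G, hO, hz, hG, hFG⟩ := hF β e z₀ hz₀
  obtain ⟨O', I', _, w', G', hO', hz', hG', hFG'⟩ := hF' β e z₀ hz₀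
  refine ⟨O ∩ O', I × I', inferInstance, fun i => w i.1 ++ w' i.2, fun i => G i.1 * G' i.2,
    hO.inter hO', ⟨hz, hz'⟩, fun i => ⟨?_, fun p hp => ?_⟩, fun z h1 h2 => ?_⟩
  · exact ((hG i.1).1.mono Set.inter_subset_left).mul ((hG' i.2).1.mono Set.inter_subset_right)
  · rcases List.mem_append.1 hp with hp | hp
    · exact (hG i.1).2 p hp
    · exact (hG' i.2).2 p hp
  · rw [Pi.mul_apply, hFG z h1 h2.1, hFG' z h1 h2.2, Finset.sum_mul_sum, Fintype.sum_prod_type]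
    simp only [smul_mul_smul_comm, List.map_append, List.prod_append, Pi.mul_apply]

/-- Smooth functions on `J^r Y` are graded functions. -/
theorem of_smooth {f : InfJet n m pr → ℝ} (hf : IsSmoothFunction r f) :
    IsGradedFunction r k (fun z : InfJet n m pr => algebraMap ℝ (Grassmann n l E z) (f z)) := by
  intro β e z₀ hz₀
  obtain ⟨O, G, hO, hz, hG, hfG⟩ := hf β z₀ hz₀.value_mem
  refine ⟨O, Unit, inferInstance, fun _ => [], fun _ => G, hO, hz, fun _ => ⟨hG, by simp⟩,
    fun z h1 h2 => ?_⟩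
  simp [hfG z h1.value_mem h2, Algebra.algebraMap_eq_smul_one]

end IsGradedFunction

variable (n m l E) in
/-- The ring `S_∞[E;Y]`, the direct limit of the rings of graded functions on the graded manifolds
with bodies `J^r Y` and structure bundles `E_r`, realized as a ring of graded functions on
`J^∞ Y` (the transition maps of the direct system are injective). -/
def SInf (pr : Y → X) : Subalgebra ℝ (∀ z : InfJet n m pr, Grassmann n l E z) where
  carrier := {F | ∃ r, IsGradedFunction r r F}
  mul_mem' := by
    rintro f g ⟨r, hf⟩ ⟨r', hg⟩
    exact ⟨max r r', (hf.mono (le_max_left _ _) (le_max_left _ _)).mul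
      (hg.mono (le_max_right _ _) (le_max_right _ _))⟩
  add_mem' := by
    rintro f g ⟨r, hf⟩ ⟨r', hg⟩
    exact ⟨max r r', (hf.mono (le_max_left _ _) (le_max_left _ _)).add
      (hg.mono (le_max_right _ _) (le_max_right _ _))⟩
  algebraMap_mem' := fun a => by
    obtain ⟨r, hr⟩ := (OInf n m pr).algebraMap_mem a
    exact ⟨r, IsGradedFunction.of_smooth hr⟩

/-- The monomorphism `O_∞ Y → S_∞[E;Y]`. -/
def oToS (pr : Y → X) : OInf n m pr →+* SInf n m l E pr where
  toFun f := ⟨fun z => algebraMap ℝ _ (f.1 z), by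
    obtain ⟨r, hr⟩ := f.2
    exact ⟨r, IsGradedFunction.of_smooth hr⟩⟩
  map_one' := by ext z; simp
  map_mul' f g := by ext z; simp
  map_zero' := by ext z; simp
  map_add' f g := by ext z; simp

/-- `S_∞[E;Y]` is an algebra over `O_∞ Y`. -/
instance (pr : Y → X) : Algebra (OInf n m pr) (SInf n m l E pr) :=
  (oToS pr).toAlgebra' fun f F => by
    ext z
    exact Algebra.commutes (f.1 z) (F.1 z)

variable (n m l E) in
/-- The submodule `S_∞[E;Y]_k` of graded functions of antifield number `k`, i.e., homogeneous of
degree `k` in the odd elements `c^a_Λ`. -/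
def SDeg (pr : Y → X) (k : ℕ) : Submodule (OInf n m pr) (SInf n m l E pr) where
  carrier := {F | ∀ z, F.1 z ∈ ⋀[ℝ]^k (Module.Dual ℝ (InfJetE n l E (InfJet.base z)))}
  add_mem' hF hG z := Submodule.add_mem _ (hF z) (hG z)
  zero_mem' z := Submodule.zero_mem _
  smul_mem' f F hF z := by
    have : (f • F).1 z = f.1 z • F.1 z := by
      rw [Algebra.smul_def, Algebra.smul_def]
      rfl
    rw [this]
    exact Submodule.smul_mem _ _ (hF z)

/-! ### Differential operators and the Koszul-Tate differential -/

variable (n m l E) in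
/-- An `E`-valued differential operator of order `q` on `Y`: a smooth bundle morphism
`J^q Y → E` over `X`, i.e., one with smooth components `E^a` in bundle coordinates. -/
structure DiffOp (pr : Y → X) (q : ℕ) where
  toFun : ∀ j : Jet n m pr q, E j.base
  smooth : ∀ (β : BundleChart n m pr) (e : FrameChart n l E) (j₀ : Jet n m pr q),
    j₀.value ∈ β.v.source → j₀.base ∈ e.e.baseSet →
    ∃ (O : Set (FinCoord n m q)) (G : Fin l → FinCoord n m q → ℝ),
      IsOpen O ∧ j₀.coord β ∈ O ∧ (∀ a, ContDiffOn ℝ ∞ (G a) O) ∧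
      ∀ j : Jet n m pr q, j.value ∈ β.v.source → j.base ∈ e.e.baseSet → j.coord β ∈ O →
        ∀ a, (e.e ⟨j.base, toFun j⟩).2 a = G a (j.coord β)

namespace DiffOp

variable {pr : Y → X} {q : ℕ} (D : DiffOp n m l E pr q)

/-- The functions `G a` of the coordinates of `J^q Y` represent the components `E^a` of the
differential operator on the open set `O` of the coordinate space. -/
structure IsLocalRep (β : BundleChart n m pr) (e : FrameChart n l E) (O : Set (FinCoord n m q))
    (G : Fin l → FinCoord n m q → ℝ) : Prop where
  isOpen : IsOpen O
  smooth : ∀ a, ContDiffOn ℝ ∞ (G a) O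
  eq : ∀ j : Jet n m pr q, j.value ∈ β.v.source → j.base ∈ e.e.baseSet → j.coord β ∈ O →
    ∀ a, (e.e ⟨j.base, D.toFun j⟩).2 a = G a (j.coord β)

/-- The kernel of the differential operator, the inverse image of the zero section of `E`. -/
def ker : Set (Jet n m pr q) := {j | D.toFun j = 0}

open Classical in
/-- The value of the differential operator on a local section of `Y`: the section
`x ↦ D (j^q_x s)` of `E`, defined near the base point (and set to be zero elsewhere). -/
def along (s : LocalSection n m pr) (x : X) : E x :=
  if h : IsLocalSection n m pr s.toFun x then D.toFun (Jet.mk q ⟨x, s.toFun, h⟩) else 0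

/-- A local section of `Y` is a solution if its jets near the base point belong to the kernel. -/
def IsSolution (s : LocalSection n m pr) : Prop :=
  ∀ᶠ x in 𝓝 s.base, ∀ h : IsLocalSection n m pr s.toFun x, Jet.mk q ⟨x, s.toFun, h⟩ ∈ D.ker

/-- The `k`-th prolongation of the kernel, as a set of points of `J^∞ Y`: it consists of the points
whose `(q + k)`-jet is represented by a local section `s` such that the section `D (j^q s)` of
`E` has zero `k`-jet at the base point (in particular, for `k = 0` the `q`-jet is in the kernel). -/
def prolongedKer (k : ℕ) : Set (InfJet n m pr) :=
  {z | ∃ s : LocalSection n m pr, Jet.mk (q + k) s = z.1 (q + k) ∧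
    ∀ (u : BaseChart n X) (e : FrameChart n l E), s.base ∈ u.u.source → s.base ∈ e.e.baseSet →
      ∀ (a : Fin l) (L : MultiIndex n), Multiset.card L ≤ k →
        secCoord u e a L s.base (D.along s) = 0}

/-- The map `d` is the value at the point `z` of the derivation `∂_a E^a` acting on the right: it is
a right antiderivation of the Grassmann algebra at `z`, and in each local basis it takes
`c^a_Λ` to `d_Λ E^a`. -/
structure IsKoszulTateAt (z : InfJet n m pr) (d : Grassmann n l E z →ₗ[ℝ] Grassmann n l E z) :
    Prop where
  mul : ∀ (F F' : Grassmann n l E z) (k : ℕ),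
    F' ∈ ⋀[ℝ]^k (Module.Dual ℝ (InfJetE n l E z.base)) →
      d (F * F') = (-1 : ℝ) ^ k • (d F * F') + F * d F'
  odd : ∀ (β : BundleChart n m pr) (e : FrameChart n l E) (hz : InDomain β e z)
    (O : Set (FinCoord n m q)) (G : Fin l → FinCoord n m q → ℝ), D.IsLocalRep β e O G →
      trunc q (z.coord β) ∈ O → ∀ (a : Fin l) (L : MultiIndex n),
        d (oddCoord β e hz (a, L)) =
          algebraMap ℝ _ (iterTotalD L (fun p => G a (trunc q p)) (z.coord β))

end DiffOp

/-- The chain complex `C` is `0 ← S₀ ← S₁ ← ⋯` with the boundary operator given by `δ`: its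
`k`-th term is the submodule `A k` of `S`, and its differentials are the restrictions of `δ`. -/
def IsComplexOf {O : Type*} {S : Type*} [CommRing O] [Ring S] [Algebra O S]
    (A : ℕ → Submodule O S) (δ : S →ₗ[O] S) (C : ChainComplex (ModuleCat O) ℕ) : Prop :=
  ∃ e : ∀ k, C.X k ≅ ModuleCat.of O (A k), ∀ k : ℕ,
    C.d (k + 1) k ≫ (e k).hom ≫ ModuleCat.ofHom (A k).subtype =
      (e (k + 1)).hom ≫ ModuleCat.ofHom (A (k + 1)).subtype ≫ ModuleCat.ofHom δ

end VectorBundle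

end KoszulTate

namespace KoszulTate

/-! ### Calculus in jet coordinates -/

section Calculus

variable {n m : ℕ}

/-! At each point `z` of `J^∞ Y` over `x`, the differential is a contraction. Local sections
representing the finite jets of `z` give, through the operator, one vector `v(z)` of `J^∞_x E`
(`DiffOp.jetAlong`), on which the linear form `c^a_Λ` takes the value `d_Λ E^a (z)`. Let `δ` at `z`
be the right contraction of the exterior algebra of the dual with evaluation at `v(z)`. Contraction
with a fixed form is a right antiderivation, kills scalars, lowers the degree by one and squares to
zero; the Leibniz rule, nilpotency and the complex are therefore pure algebra.

The analysis lies in the existence of `v(z)` and its value on `c^a_Λ`. Both rest on the chain rule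
`∂_Λ (g ∘ j^∞ σ) = (d_Λ g) ∘ j^∞ σ` (`IsSmoothOn.iterD_prolong`). If `g` has order `q` and `|Λ| ≤
k`, the right side sees only the `(q + k)`-jet, so the `k`-jet of the operator along a section
depends only on that jet (`IsLocalRep.secCoord_along_infJet`). The `k`-jets obtained from unrelated
representatives are thus compatible, and no single section representing all of `z` is needed.

The remaining claims are read off from monomials: an antiderivation deletes one letter `c^a_Λ` at a
time, at the cost of a factor `± d_Λ E^a` (`IsRightAntiderivation.map_monomial`). This yields
uniqueness, smoothness of `δ F`, and vanishing on the prolonged kernel, where the factors are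
derivatives of a section with zero `k`-jet. The grading exists because monomials are homogeneous and
only finitely many odd letters have bounded jet order, which bounds the degree. -/

theorem partialD_comm (i j : Fin n) {f : Euc n → ℝ} {p : Euc n} (hf : ContDiffAt ℝ ∞ f p) :
    partialD i (partialD j f) p = partialD j (partialD i f) p := by
  have hd : DifferentiableAt ℝ (fderiv ℝ f) p :=
    (hf.fderiv_right (m := 1) (by norm_cast)).differentiableAt (by simp)
  have key : ∀ i j : Fin n, partialD i (partialD j f) p =
      fderiv ℝ (fderiv ℝ f) p (EuclideanSpace.single i 1) (EuclideanSpace.single j 1) := by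
    intro i j
    change fderiv ℝ (fun y => fderiv ℝ f y (EuclideanSpace.single j 1)) p _ = _
    rw [fderiv_clm_apply hd (differentiableAt_const _)]
    simp
  rw [key, key]
  exact (hf.isSymmSndFDerivAt (by simpa using (by norm_cast : (2 : WithTop ℕ∞) ≤ ∞))) _ _

/-- Symmetry of second derivatives handles each adjacent swap. Equality is kept near `p`, not just
at `p`, so that it survives further differentiation. -/
theorem foldr_partialD_perm {f : Euc n → ℝ} {p : Euc n} {s t : List (Fin n)} (h : s.Perm t)
    (hf : ∀ᶠ q in 𝓝 p, ContDiffAt ℝ ∞ f q) :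
    s.foldr partialD f =ᶠ[𝓝 p] t.foldr partialD f := by
  induction h with
  | nil => exact Filter.EventuallyEq.rfl
  | cons i _ ih => exact partialD_congr i ih
  | swap i j s =>
    filter_upwards [foldr_smooth s hf] with q hq
    exact partialD_comm _ _ hq
  | trans _ _ ih ih' => exact ih.trans ih'

theorem iterD_cons {f : Euc n → ℝ} {p : Euc n} (i : Fin n) (L : MultiIndex n)
    (hf : ∀ᶠ q in 𝓝 p, ContDiffAt ℝ ∞ f q) :
    iterD (i ::ₘ L) f =ᶠ[𝓝 p] partialD i (iterD L f) :=
  -- `Multiset.toList` picks an arbitrary order, so the two lists agree only up to permutation.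
  foldr_partialD_perm (s := (i ::ₘ L).toList) (t := i :: L.toList)
    (Multiset.coe_eq_coe.1 (by rw [← Multiset.cons_coe]; simp)) hf

/-- The coordinates of the infinite jet at `p` of the section with components `σ`. -/
def prolong (σ : Fin m → Euc n → ℝ) (p : Euc n) : InfCoord n m :=
  (p, fun j L => iterD L (σ j) p)

/-- Differentiating `∂_Λ σ` along `x^i` gives `∂_{i+Λ} σ`: the tangent vectors of a prolonged
section are exactly the directions used by `totalD`. -/
theorem prolong_hasFDerivAt {σ : Fin m → Euc n → ℝ} {p : Euc n}
    (hσ : ∀ j, ∀ᶠ q in 𝓝 p, ContDiffAt ℝ ∞ (σ j) q) (r : ℕ) :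
    ∃ A : Euc n →L[ℝ] FinCoord n m r, HasFDerivAt (fun q => trunc r (prolong σ q)) A p ∧
      ∀ i, A (EuclideanSpace.single i 1) = (EuclideanSpace.single i 1,
        fun j L => (prolong σ p).2 j (i ::ₘ L.1)) := by
  have h : ∀ (j : Fin m) (L : MultiIndex n), HasFDerivAt (iterD L (σ j))
      (fderiv ℝ (iterD L (σ j)) p) p := fun j L =>
    ((foldr_smooth L.toList (hσ j)).self_of_nhds.differentiableAt (by simp)).hasFDerivAt
  refine ⟨(ContinuousLinearMap.id ℝ _).prod (ContinuousLinearMap.pi fun j =>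
    ContinuousLinearMap.pi fun L : MultiIndexLE n r => fderiv ℝ (iterD L.1 (σ j)) p),
    (hasFDerivAt_id p).prodMk (hasFDerivAt_pi.2 fun j => hasFDerivAt_pi.2 fun L => h j L.1), ?_⟩
  intro i
  refine Prod.ext rfl (funext fun j => funext fun L => ?_)
  exact (iterD_cons i L.1 (hσ j)).eq_of_nhds.symm

theorem prolong_contDiffAt {σ : Fin m → Euc n → ℝ} {p : Euc n}
    (hσ : ∀ j, ∀ᶠ q in 𝓝 p, ContDiffAt ℝ ∞ (σ j) q) (r : ℕ) :
    ContDiffAt ℝ ∞ (fun q => trunc r (prolong σ q)) p :=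
  contDiffAt_id.prodMk (contDiffAt_pi.2 fun j => contDiffAt_pi.2 fun L =>
    (foldr_smooth L.1.toList (hσ j)).self_of_nhds)

/-- On the points whose jet coordinates of order at most `r` lie in `O`, the function `g` depends
smoothly on these coordinates only. -/
def IsSmoothOn (r : ℕ) (O : Set (FinCoord n m r)) (g : InfCoord n m → ℝ) : Prop :=
  ∃ G : FinCoord n m r → ℝ, ContDiffOn ℝ ∞ G O ∧ ∀ p, trunc r p ∈ O → g p = G (trunc r p)

/-- Truncation is linear, so a line in the infinite jet coordinates projects to a line in finitely
many of them, where `G` has a Fréchet derivative. -/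
theorem totalD_eq_fderiv {r : ℕ} {O : Set (FinCoord n m r)} (hO : IsOpen O)
    {g : InfCoord n m → ℝ} {G : FinCoord n m r → ℝ} (hG : ContDiffOn ℝ ∞ G O)
    (hgG : ∀ p, trunc r p ∈ O → g p = G (trunc r p)) (i : Fin n) {p : InfCoord n m}
    (hp : trunc r p ∈ O) :
    totalD i g p = fderiv ℝ G (trunc r p) (EuclideanSpace.single i 1,
      fun j L => p.2 j (i ::ₘ L.1)) := by
  have hd : DifferentiableAt ℝ G (trunc r p) :=
    (hG.contDiffAt (hO.mem_nhds hp)).differentiableAt (by simp)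
  rw [← hd.lineDeriv_eq_fderiv]
  refine Filter.EventuallyEq.deriv_eq ?_
  -- For small `t` the projected line stays in the open set `O`, where `g` is given by `G`.
  have hc : ContinuousAt (fun t : ℝ => trunc r p + t • (trunc r
      ((EuclideanSpace.single i 1, fun j L => p.2 j (i ::ₘ L)) : InfCoord n m))) 0 := by
    fun_prop
  have := hc.eventually (p := (· ∈ O)) (by
    simpa using hO.mem_nhds hp)
  filter_upwards [this] with t ht
  exact hgG _ ht

namespace IsSmoothOn

variable {r r' : ℕ} {O : Set (FinCoord n m r)} {g : InfCoord n m → ℝ}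

theorem congr (hg : IsSmoothOn r O g) {p p' : InfCoord n m} (hp : trunc r p ∈ O)
    (h : trunc r p = trunc r p') : g p = g p' := by
  obtain ⟨G, -, hgG⟩ := hg
  rw [hgG p hp, hgG p' (h ▸ hp), h]

theorem mono (h : r ≤ r') (hg : IsSmoothOn r O g) : IsSmoothOn r' (restr h ⁻¹' O) g := by
  obtain ⟨G, hG, hgG⟩ := hg
  exact ⟨G ∘ restr h, hG.comp (restr h).contDiff.contDiffOn (fun _ hp => hp), fun p hp => hgG p hp⟩

/-- The order grows by one because the direction involves `y^j_{i+Λ}` with `|Λ| = r`. -/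
theorem totalD (hO : IsOpen O) (hg : IsSmoothOn r O g) (i : Fin n) :
    IsSmoothOn (r + 1) (restr r.le_succ ⁻¹' O) (totalD i g) := by
  obtain ⟨G, hG, hgG⟩ := hg
  refine ⟨fun p => fderiv ℝ G (restr r.le_succ p) (EuclideanSpace.single i 1,
      fun j L => p.2 j ⟨i ::ₘ L.1, by have := L.2; simpa using this⟩), ?_,
    fun p hp => totalD_eq_fderiv hO hG hgG i hp⟩
  refine ContDiffOn.clm_apply ?_ ?_
  · exact (hG.fderiv_of_isOpen (m := ∞) hO (by simp)).comp
      (restr r.le_succ).contDiff.contDiffOn (fun _ hp => hp)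
  · refine ContDiff.contDiffOn ?_
    refine contDiff_const.prodMk (contDiff_pi.2 fun j => contDiff_pi.2 fun L => ?_)
    exact contDiff_apply_apply (𝕜 := ℝ) (E := ℝ) j _ |>.comp contDiff_snd

/-- The chain rule for `G` composed with the truncated prolongation; this is what total derivatives
are made for. -/
theorem partialD_prolong (hO : IsOpen O) (hg : IsSmoothOn r O g) (i : Fin n)
    {σ : Fin m → Euc n → ℝ} {p : Euc n} (hσ : ∀ j, ∀ᶠ q in 𝓝 p, ContDiffAt ℝ ∞ (σ j) q)
    (hp : trunc r (prolong σ p) ∈ O) :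
    partialD i (fun q => g (prolong σ q)) p = KoszulTate.totalD i g (prolong σ p) := by
  obtain ⟨G, hG, hgG⟩ := hg
  rw [totalD_eq_fderiv hO hG hgG i hp]
  obtain ⟨A, hA, hAi⟩ := prolong_hasFDerivAt hσ r
  have hd : DifferentiableAt ℝ G (trunc r (prolong σ p)) :=
    (hG.contDiffAt (hO.mem_nhds hp)).differentiableAt (by simp)
  have h1 := hd.hasFDerivAt.comp p hA
  have h2 : (fun q => g (prolong σ q)) =ᶠ[𝓝 p] G ∘ fun q => trunc r (prolong σ q) := by
    filter_upwards [hA.continuousAt.eventually (hO.mem_nhds hp)] with q hq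
    exact hgG _ hq
  rw [partialD, h2.fderiv_eq, h1.fderiv, ContinuousLinearMap.comp_apply, hAi]

theorem foldr_totalD (hO : IsOpen O) (hg : IsSmoothOn r O g) (s : List (Fin n)) :
    IsSmoothOn (r + s.length) (restr (Nat.le_add_right _ _) ⁻¹' O)
      (s.foldr KoszulTate.totalD g) := by
  induction s with
  | nil => exact hg
  | cons i s ih => exact ih.totalD (hO.preimage (restr _).continuous) i

/-- Iterates the chain rule with the same list on both sides, so commutativity of total derivatives
is never needed. -/
theorem foldr_partialD_prolong (hO : IsOpen O) (hg : IsSmoothOn r O g) (s : List (Fin n))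
    {σ : Fin m → Euc n → ℝ} {p : Euc n} (hσ : ∀ j, ∀ᶠ q in 𝓝 p, ContDiffAt ℝ ∞ (σ j) q)
    (hp : trunc r (prolong σ p) ∈ O) :
    s.foldr partialD (fun q => g (prolong σ q)) =ᶠ[𝓝 p]
      fun q => s.foldr KoszulTate.totalD g (prolong σ q) := by
  induction s with
  | nil => exact Filter.EventuallyEq.rfl
  | cons i s ih =>
    refine (partialD_congr i ih).trans ?_
    filter_upwards [Filter.eventually_all.2 fun j => (hσ j).eventually_nhds,
      (prolong_contDiffAt hσ r).continuousAt.eventually (hO.mem_nhds hp)] with q h1 h2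
    exact partialD_prolong (hO.preimage (restr _).continuous) (hg.foldr_totalD hO s) i h1 h2

theorem iterTotalD (hO : IsOpen O) (hg : IsSmoothOn r O g) (L : MultiIndex n) {k : ℕ}
    (hL : Multiset.card L ≤ k) :
    IsSmoothOn (r + k) (restr (Nat.le_add_right _ _) ⁻¹' O) (iterTotalD L g) := by
  have h : r + L.toList.length ≤ r + k := by simpa using hL
  exact (hg.foldr_totalD hO L.toList).mono h

theorem iterD_prolong (hO : IsOpen O) (hg : IsSmoothOn r O g) (L : MultiIndex n)
    {σ : Fin m → Euc n → ℝ} {p : Euc n} (hσ : ∀ j, ∀ᶠ q in 𝓝 p, ContDiffAt ℝ ∞ (σ j) q)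
    (hp : trunc r (prolong σ p) ∈ O) :
    iterD L (fun q => g (prolong σ q)) p = KoszulTate.iterTotalD L g (prolong σ p) :=
  (hg.foldr_partialD_prolong hO L.toList hσ hp).eq_of_nhds

end IsSmoothOn

end Calculus

/-! ### Right antiderivations of exterior algebras -/

section Exterior

variable {M : Type*} [AddCommGroup M] [Module ℝ M]

/-- The monomial `φ p₁ ∧ ⋯ ∧ φ pₛ` that corresponds to a word `p₁ ... pₛ`. -/
def monomial {P : Type*} (φ : P → M) (w : List P) : ExteriorAlgebra ℝ M :=
  (w.map fun p => ExteriorAlgebra.ι ℝ (φ p)).prod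

theorem monomial_cons {P : Type*} (φ : P → M) (p : P) (w : List P) :
    monomial φ (p :: w) = ExteriorAlgebra.ι ℝ (φ p) * monomial φ w := by
  simp [monomial]

theorem ι_mem_exteriorPower_one (x : M) : ExteriorAlgebra.ι ℝ x ∈ ⋀[ℝ]^1 M := by
  rw [ExteriorAlgebra.exteriorPower, pow_one]
  exact LinearMap.mem_range_self _ x

theorem monomial_mem {P : Type*} (φ : P → M) (w : List P) :
    monomial φ w ∈ ⋀[ℝ]^w.length M := by
  induction w with
  | nil => exact SetLike.GradedOne.one_mem (A := fun i : ℕ => ⋀[ℝ]^i M)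
  | cons p w ih =>
    rw [monomial_cons, List.length_cons, add_comm]
    exact SetLike.GradedMul.mul_mem (A := fun i : ℕ => ⋀[ℝ]^i M) (ι_mem_exteriorPower_one _) ih

theorem monomial_eq_zero {P : Type*} (φ : P → M) {w : List P} (hw : ¬ w.Nodup) :
    monomial φ w = 0 := by
  have h := ExteriorAlgebra.ιMulti_eq_zero_of_not_inj (R := ℝ)
    (v := fun i : Fin w.length => φ (w.get i))
    (fun hinj => hw (List.nodup_iff_injective_get.2 hinj.of_comp))
  rw [ExteriorAlgebra.ιMulti_apply] at h
  rw [monomial, ← h]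
  congr 1
  apply List.ext_get <;> simp

theorem algebraMapInv_monomial {P : Type*} (φ : P → M) (w : List P) :
    ExteriorAlgebra.algebraMapInv (monomial φ w) = if w = [] then (1 : ℝ) else 0 := by
  cases w with
  | nil => simp [monomial]
  | cons p w => simp [monomial_cons, ExteriorAlgebra.algebraMapInv]

theorem algebraMap_algebraMapInv {x : ExteriorAlgebra ℝ M} (hx : x ∈ ⋀[ℝ]^0 M) :
    algebraMap ℝ _ (ExteriorAlgebra.algebraMapInv x) = x := by
  rw [ExteriorAlgebra.exteriorPower, pow_zero] at hx
  obtain ⟨a, rfl⟩ := Submodule.mem_one.1 hx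
  rw [ExteriorAlgebra.algebraMap_leftInverse M a]

/-- The graded Leibniz rule for operators acting on the right. -/
def IsRightAntiderivation (d : ExteriorAlgebra ℝ M →ₗ[ℝ] ExteriorAlgebra ℝ M) : Prop :=
  ∀ (x y : ExteriorAlgebra ℝ M) (k : ℕ), y ∈ ⋀[ℝ]^k M →
    d (x * y) = (-1 : ℝ) ^ k • (d x * y) + x * d y

theorem IsRightAntiderivation.map_one {d : ExteriorAlgebra ℝ M →ₗ[ℝ] ExteriorAlgebra ℝ M}
    (hd : IsRightAntiderivation d) : d 1 = 0 := by
  have := hd 1 1 0 (SetLike.GradedOne.one_mem (A := fun i : ℕ => ⋀[ℝ]^i M))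
  simpa using this

/-- An operator acting from the right passes the `w.length - 1 - i` letters to the right of position
`i` before it reaches that letter, whence the sign. Values on the letters therefore determine the
operator on all monomials. -/
theorem IsRightAntiderivation.map_monomial {d : ExteriorAlgebra ℝ M →ₗ[ℝ] ExteriorAlgebra ℝ M}
    (hd : IsRightAntiderivation d) {P : Type*} {φ : P → M} {c : P → ℝ}
    (hc : ∀ p, d (ExteriorAlgebra.ι ℝ (φ p)) = algebraMap ℝ _ (c p)) (w : List P) :
    d (monomial φ w) = ∑ i : Fin w.length,
      ((-1) ^ (w.length - 1 - i) * c (w.get i)) • monomial φ (w.eraseIdx i) := by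
  induction w with
  | nil => simpa [monomial] using hd.map_one
  | cons p w ih =>
    rw [monomial_cons, hd _ _ _ (monomial_mem φ w), ih, hc]
    simp only [List.length_cons]
    rw [Fin.sum_univ_succ, Finset.mul_sum]
    congr 1
    · simp [Algebra.algebraMap_eq_smul_one, smul_smul]
    · refine Finset.sum_congr rfl fun i _ => ?_
      simp only [Fin.val_succ, List.eraseIdx_cons_succ, monomial_cons,
        mul_smul_comm]
      congr 3
      omega

/-- The contraction with a linear form, acting on the right. -/
def contract (v : Module.Dual ℝ M) : ExteriorAlgebra ℝ M →ₗ[ℝ] ExteriorAlgebra ℝ M :=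
  CliffordAlgebra.contractRight.flip v

theorem contract_ι (v : Module.Dual ℝ M) (x : M) :
    contract v (ExteriorAlgebra.ι ℝ x) = algebraMap ℝ _ (v x) :=
  CliffordAlgebra.contractRight_ι _ _ _

theorem contract_contract (v : Module.Dual ℝ M) (x : ExteriorAlgebra ℝ M) :
    contract v (contract v x) = 0 :=
  CliffordAlgebra.contractRight_contractRight _ _

theorem contract_algebraMap (v : Module.Dual ℝ M) (a : ℝ) :
    contract v (algebraMap ℝ _ a) = 0 :=
  CliffordAlgebra.contractRight_algebraMap _ _ _

theorem contract_mul_ι (v : Module.Dual ℝ M) (x : ExteriorAlgebra ℝ M) (a : M) :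
    contract v (x * ExteriorAlgebra.ι ℝ a) =
      v a • x - contract v x * ExteriorAlgebra.ι ℝ a :=
  CliffordAlgebra.contractRight_mul_ι _ _ _

/-- Induction on the degree of `y`, splitting off its last vector: each vector passed by the
contraction contributes one sign. -/
theorem contract_isRightAntiderivation (v : Module.Dual ℝ M) :
    IsRightAntiderivation (contract v) := by
  intro x y k hy
  induction hy using Submodule.pow_induction_on_right' with
  | algebraMap a =>
    have h : contract v (x * algebraMap ℝ _ a) = contract v x * algebraMap ℝ _ a :=
      CliffordAlgebra.contractRight_mul_algebraMap _ _ _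
    simp [h, contract_algebraMap]
  | add y y' k _ _ ih ih' =>
    simp only [mul_add, map_add, ih, ih', smul_add]
    abel
  | mul_mem k y hy ih m hm =>
    obtain ⟨a, rfl⟩ := hm
    rw [← mul_assoc, contract_mul_ι, ih, contract_mul_ι]
    simp only [pow_succ, mul_neg, mul_one, neg_smul, add_mul, smul_mul_assoc, mul_sub, mul_assoc,
      mul_smul_comm]
    abel

theorem contract_mem (v : Module.Dual ℝ M) {k : ℕ} {x : ExteriorAlgebra ℝ M}
    (hx : x ∈ ⋀[ℝ]^(k + 1) M) : contract v x ∈ ⋀[ℝ]^k M := by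
  induction k generalizing x with
  | zero =>
    rw [ExteriorAlgebra.exteriorPower, zero_add, pow_one] at hx
    obtain ⟨a, rfl⟩ := hx
    rw [contract_ι, ExteriorAlgebra.exteriorPower, pow_zero]
    exact Submodule.mem_one.2 ⟨_, rfl⟩
  | succ k ih =>
    rw [ExteriorAlgebra.exteriorPower, pow_succ] at hx
    refine Submodule.mul_induction_on hx (fun y hy m hm => ?_) (fun y y' hy hy' => ?_)
    · obtain ⟨a, rfl⟩ := hm
      rw [contract_mul_ι]
      refine Submodule.sub_mem _ (Submodule.smul_mem _ _ hy) ?_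
      exact SetLike.GradedMul.mul_mem (A := fun i : ℕ => ⋀[ℝ]^i M) (ih hy)
        (ι_mem_exteriorPower_one a)
    · rw [map_add]
      exact Submodule.add_mem _ hy hy'

/-- The homogeneous component of degree `k`. -/
def component (k : ℕ) : ExteriorAlgebra ℝ M →ₗ[ℝ] ExteriorAlgebra ℝ M :=
  GradedAlgebra.proj (fun i : ℕ => ⋀[ℝ]^i M) k

theorem component_mem (k : ℕ) (x : ExteriorAlgebra ℝ M) : component k x ∈ ⋀[ℝ]^k M :=
  SetLike.coe_mem (DirectSum.decompose (fun i : ℕ => ⋀[ℝ]^i M) x k)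

theorem component_of_mem {k j : ℕ} {x : ExteriorAlgebra ℝ M} (hx : x ∈ ⋀[ℝ]^j M) :
    component k x = if j = k then x else 0 := by
  split_ifs with h
  · subst h
    exact DirectSum.decompose_of_mem_same (fun i : ℕ => ⋀[ℝ]^i M) hx
  · exact DirectSum.decompose_of_mem_ne (fun i : ℕ => ⋀[ℝ]^i M) hx h

end Exterior

/-! ### Charts and jets of sections -/

section Jets

variable {n m : ℕ}
  {X : Type*} [TopologicalSpace X] [ChartedSpace (Euc n) X]
  {Y : Type*} [TopologicalSpace Y] [ChartedSpace (ModelProd (Euc n) (Euc m)) Y]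
  {pr : Y → X}

/-- The preferred chart of the base at a point. -/
def BaseChart.atPoint [IsManifold (𝓡 n) ∞ X] (x : X) : BaseChart n X where
  u := chartAt (Euc n) x
  smooth := contMDiffOn_chart
  smooth_symm := contMDiffOn_chart_symm

/-- Compose a local trivialization with the product of `u` and a chart of the typical fiber. The
base chart is prescribed because vanishing of a jet of `E` is tested in every base chart. -/
theorem IsSmoothFiberBundle.exists_bundleChart {V : Type*} [TopologicalSpace V]
    [ChartedSpace (Euc m) V] [IsManifold (𝓡 m) ∞ V] (hpr : IsSmoothFiberBundle n m V pr)
    (u : BaseChart n X) {y : Y} (hy : pr y ∈ u.u.source) :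
    ∃ β : BundleChart n m pr, β.toBaseChart = u ∧ y ∈ β.v.source := by
  obtain ⟨t, ht, hs, hs'⟩ := hpr.locally_trivial (pr y)
  let c := chartAt (Euc m) (t y).2
  have hc : ContMDiffOn (𝓡 m) (𝓡 m) ∞ c c.source := contMDiffOn_chart
  have hc' : ContMDiffOn (𝓡 m) (𝓡 m) ∞ c.symm c.target := contMDiffOn_chart_symm
  have mem : ∀ y' ∈ (t.toOpenPartialHomeomorph ≫ₕ u.u.prod c).source,
      y' ∈ t.source ∧ pr y' ∈ u.u.source ∧ (t y').2 ∈ c.source := by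
    intro y' hy'
    rw [OpenPartialHomeomorph.trans_source] at hy'
    have h1 : y' ∈ t.source := hy'.1
    have h2 : t y' ∈ u.u.source ×ˢ c.source := hy'.2
    exact ⟨h1, t.coe_fst h1 ▸ h2.1, h2.2⟩
  refine ⟨{ toBaseChart := u
            v := t.toOpenPartialHomeomorph ≫ₕ u.u.prod c
            smooth_v := ?_
            smooth_v_symm := ?_
            proj_mem := fun y' hy' => (mem y' hy').2.1
            proj_eq := fun y' hy' => congrArg u.u (t.coe_fst (mem y' hy').1) }, rfl, ?_⟩
  · refine (u.smooth.prodMap hc).comp (hs.mono fun y' hy' => (mem y' hy').1) ?_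
    intro y' hy'
    rw [OpenPartialHomeomorph.trans_source] at hy'
    exact hy'.2
  · refine hs'.comp ((u.smooth_symm.prodMap hc').mono ?_) ?_
    · intro p hp
      rw [OpenPartialHomeomorph.trans_target] at hp
      exact hp.1
    · intro p hp
      rw [OpenPartialHomeomorph.trans_target] at hp
      exact hp.2
  · rw [OpenPartialHomeomorph.trans_source]
    have h1 : y ∈ t.source := t.mem_source.2 ht
    have h2 : t y ∈ u.u.source ×ˢ c.source :=
      ⟨by rw [t.coe_fst h1]; exact hy, mem_chart_source _ _⟩
    exact ⟨h1, h2⟩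

/-- The components `y^i ∘ s` of a section in a bundle chart. -/
def BundleChart.components (β : BundleChart n m pr) (s : X → Y) (i : Fin m) (p : Euc n) : ℝ :=
  (β.v (s (β.u.symm p))).2 i

namespace LocalSection

variable (s : LocalSection n m pr)

theorem pr_value : pr (s.toFun s.base) = s.base :=
  s.isLocalSection.self_of_nhds.2

variable {s} {β : BundleChart n m pr}

theorem base_mem (hs : s.toFun s.base ∈ β.v.source) : s.base ∈ β.u.source :=
  s.pr_value ▸ β.proj_mem _ hs

theorem tendsto_symm (hs : s.toFun s.base ∈ β.v.source) :
    Filter.Tendsto β.u.symm (𝓝 (β.u s.base)) (𝓝 s.base) := by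
  have := β.u.continuousAt_symm (β.u.map_source (base_mem hs))
  rwa [ContinuousAt, β.u.left_inv (base_mem hs)] at this

theorem eventually_mem (hs : s.toFun s.base ∈ β.v.source) :
    ∀ᶠ x in 𝓝 s.base, s.toFun x ∈ β.v.source :=
  s.isLocalSection.self_of_nhds.1.continuousAt.eventually (β.v.open_source.mem_nhds hs)

theorem eventually_chart (hs : s.toFun s.base ∈ β.v.source) :
    ∀ᶠ p in 𝓝 (β.u s.base), p ∈ β.u.target ∧ IsLocalSection n m pr s.toFun (β.u.symm p) ∧
      s.toFun (β.u.symm p) ∈ β.v.source := by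
  filter_upwards [β.u.open_target.mem_nhds (β.u.map_source (base_mem hs)),
    (tendsto_symm hs).eventually s.isLocalSection.eventually_nhds,
    (tendsto_symm hs).eventually (eventually_mem hs)] with p h1 h2 h3
  exact ⟨h1, h2, h3⟩

theorem components_smooth (hs : s.toFun s.base ∈ β.v.source) (i : Fin m) :
    ∀ᶠ p in 𝓝 (β.u s.base), ContDiffAt ℝ ∞ (β.components s.toFun i) p := by
  filter_upwards [eventually_chart hs] with p ⟨h1, h2, h3⟩
  have k1 : ContMDiffAt (𝓡 n) (𝓡 n) ∞ β.u.symm p :=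
    β.smooth_symm.contMDiffAt (β.u.open_target.mem_nhds h1)
  have k2 : ContMDiffAt ((𝓡 n).prod (𝓡 m)) ((𝓡 n).prod (𝓡 m)) ∞ β.v (s.toFun (β.u.symm p)) :=
    β.smooth_v.contMDiffAt (β.v.open_source.mem_nhds h3)
  have k3 : ContMDiffAt (𝓡 n) ((𝓡 n).prod (𝓡 m)) ∞ (fun p => β.v (s.toFun (β.u.symm p))) p :=
    ContMDiffAt.comp (g := β.v) (f := fun p => s.toFun (β.u.symm p)) p k2
      (ContMDiffAt.comp (g := s.toFun) p h2.self_of_nhds.1 k1)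
  have k4 : ContDiffAt ℝ ∞ (fun p => (β.v (s.toFun (β.u.symm p))).2) p := k3.snd.contDiffAt
  exact (contDiffAt_piLp_apply (p := 2) (i := i)).comp p k4

end LocalSection

theorem Jet.mk_rep {r : ℕ} (j : Jet n m pr r) : Jet.mk r j.rep = j :=
  Quotient.out_eq (s := jetSetoid n m pr r) j

theorem Jet.jetCoord_rep {r : ℕ} {j : Jet n m pr r} {s : LocalSection n m pr}
    (h : j = Jet.mk r s) {β : BundleChart n m pr} (hs : s.toFun s.base ∈ β.v.source) (i : Fin m)
    {L : MultiIndex n} (hL : Multiset.card L ≤ r) : jetCoord β j.rep i L = jetCoord β s i L := by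
  have h1 : (jetSetoid n m pr r).r s j.rep := Quotient.exact (h.symm.trans j.mk_rep.symm)
  exact (h1.2.2 β hs i L hL).symm

theorem Jet.coord_mk {r : ℕ} {β : BundleChart n m pr} {s : LocalSection n m pr}
    (hs : s.toFun s.base ∈ β.v.source) :
    (Jet.mk r s).coord β = trunc r (prolong (β.components s.toFun) (β.u s.base)) :=
  Prod.ext rfl (funext fun i => funext fun L => Jet.jetCoord_rep rfl hs i L.2)

namespace InfJet

variable {z : InfJet n m pr} {s : LocalSection n m pr} {r : ℕ}

theorem eq_mk_of_le (h : z.1 r = Jet.mk r s) {k : ℕ} (hk : k ≤ r) : z.1 k = Jet.mk k s := by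
  induction r, hk using Nat.le_induction with
  | base => exact h
  | succ r _ ih => exact ih (by rw [← z.2 r, h]; rfl)

theorem base_eq (h : z.1 r = Jet.mk r s) : z.base = s.base := by
  rw [base, eq_mk_of_le h r.zero_le]; rfl

theorem value_eq (h : z.1 r = Jet.mk r s) : z.value = s.toFun s.base := by
  rw [value, eq_mk_of_le h r.zero_le]; rfl

theorem pr_value (z : InfJet n m pr) : pr z.value = z.base := by
  have h := (z.1 0).mk_rep.symm
  rw [value_eq h, base_eq h]
  exact LocalSection.pr_value _

/-- `InfJet.coord` uses a different representative for each order `|Λ|`; compatibility of the jets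
lets one representative of the `r`-jet supply all coordinates up to order `r`. -/
theorem trunc_coord (h : z.1 r = Jet.mk r s) {β : BundleChart n m pr}
    (hz : z.value ∈ β.v.source) :
    trunc r (z.coord β) = trunc r (prolong (β.components s.toFun) (β.u s.base)) :=
  Prod.ext (congrArg β.u (base_eq h)) (funext fun i => funext fun L =>
    Jet.jetCoord_rep (eq_mk_of_le h L.2) (value_eq h ▸ hz) i le_rfl)

theorem coord_eq_trunc {β : BundleChart n m pr} (hz : z.value ∈ β.v.source) (r : ℕ) :
    (z.1 r).coord β = trunc r (z.coord β) := by
  have h := (z.1 r).mk_rep.symm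
  rw [trunc_coord h hz, ← Jet.coord_mk (value_eq h ▸ hz), ← h]

theorem value_apply (z : InfJet n m pr) (r : ℕ) : (z.1 r).value = z.value := by
  have h := (z.1 r).mk_rep.symm
  rw [value_eq h, h]
  change (z.1 r).rep.toFun _ = _
  rw [← h]

theorem base_apply (z : InfJet n m pr) (r : ℕ) : (z.1 r).base = z.base := by
  have h := (z.1 r).mk_rep.symm
  rw [base_eq h, h]
  change (z.1 r).rep.base = _
  rw [← h]

end InfJet

end Jets

/-! ### Differential operators along sections and the infinite jet they determine -/

section Operators

set_option linter.unusedSectionVars false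

variable {n m l : ℕ}
  {X : Type*} [TopologicalSpace X] [ChartedSpace (Euc n) X]
  {E : X → Type*} [∀ x, AddCommGroup (E x)] [∀ x, Module ℝ (E x)]
  [TopologicalSpace (TotalSpace (Euc l) E)] [∀ x, TopologicalSpace (E x)]
  [FiberBundle (Euc l) E] [VectorBundle ℝ (Euc l) E] [IsManifold (𝓡 n) ∞ X]
  [ContMDiffVectorBundle ∞ (Euc l) E (𝓡 n)]
  {Y : Type*} [TopologicalSpace Y] [ChartedSpace (ModelProd (Euc n) (Euc m)) Y]
  {pr : Y → X}

variable (n l E) in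
/-- The preferred linear trivialization at a point. -/
def FrameChart.atPoint (x : X) : FrameChart n l E where
  e := trivializationAt (Euc l) E x
  isLinear := inferInstance
  smooth := Bundle.Trivialization.contMDiffOn _
  smooth_symm := Bundle.Trivialization.contMDiffOn_symm _

theorem FrameChart.mem_atPoint (x : X) : x ∈ (FrameChart.atPoint n l E x).e.baseSet :=
  FiberBundle.mem_baseSet_trivializationAt (Euc l) E x

namespace DiffOp

variable {q : ℕ} (D : DiffOp n m l E pr q)

variable {D} in
theorem IsLocalRep.isSmoothOn {β : BundleChart n m pr} {e : FrameChart n l E}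
    {O : Set (FinCoord n m q)} {G : Fin l → FinCoord n m q → ℝ} (hG : D.IsLocalRep β e O G)
    (a : Fin l) : IsSmoothOn q O (fun p => G a (trunc q p)) :=
  ⟨G a, hG.smooth a, fun _ _ => rfl⟩

theorem exists_isLocalRep {β : BundleChart n m pr} {e : FrameChart n l E} {j : Jet n m pr q}
    (hj : j.value ∈ β.v.source) (he : j.base ∈ e.e.baseSet) :
    ∃ O G, D.IsLocalRep β e O G ∧ j.coord β ∈ O := by
  obtain ⟨O, G, h1, h2, h3, h4⟩ := D.smooth β e j hj he
  exact ⟨O, G, ⟨h1, h3, h4⟩, h2⟩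

variable {s : LocalSection n m pr} {β : BundleChart n m pr} {e : FrameChart n l E}
  {O : Set (FinCoord n m q)} {G : Fin l → FinCoord n m q → ℝ}

theorem along_of_isLocalSection {x : X} (h : IsLocalSection n m pr s.toFun x) :
    D.along s x = D.toFun (Jet.mk q ⟨x, s.toFun, h⟩) :=
  dif_pos h

variable {D} in
-- In coordinates the section `D (j^q s)` is `G` composed with the prolongation of `s`. This holds
-- on a whole neighbourhood, so both sides can be differentiated.
theorem IsLocalRep.along_eventuallyEq (hG : D.IsLocalRep β e O G)
    (hs : s.toFun s.base ∈ β.v.source) (he : s.base ∈ e.e.baseSet)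
    (hO : trunc q (prolong (β.components s.toFun) (β.u s.base)) ∈ O) :
    ∀ᶠ p in 𝓝 (β.u s.base), ∀ a, (e.e ⟨β.u.symm p, D.along s (β.u.symm p)⟩).2 a =
      G a (trunc q (prolong (β.components s.toFun) p)) := by
  filter_upwards [LocalSection.eventually_chart hs,
    (LocalSection.tendsto_symm hs).eventually (e.e.open_baseSet.mem_nhds he),
    (prolong_contDiffAt (LocalSection.components_smooth hs) q).continuousAt.eventually
      (hG.isOpen.mem_nhds hO)] with p ⟨h1, h2, h3⟩ h4 h5 a
  have hc : (Jet.mk q (⟨β.u.symm p, s.toFun, h2⟩ : LocalSection n m pr)).coord β =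
      trunc q (prolong (β.components s.toFun) p) := by
    rw [Jet.coord_mk h3]
    simp only [β.u.right_inv h1]
  have := hG.eq (Jet.mk q ⟨β.u.symm p, s.toFun, h2⟩) h3 h4 (by rw [hc]; exact h5) a
  rw [hc] at this
  rw [← this, D.along_of_isLocalSection h2]
  rfl

variable {D} in
theorem IsLocalRep.secCoord_along (hG : D.IsLocalRep β e O G)
    (hs : s.toFun s.base ∈ β.v.source) (he : s.base ∈ e.e.baseSet)
    (hO : trunc q (prolong (β.components s.toFun) (β.u s.base)) ∈ O) (a : Fin l)
    (L : MultiIndex n) :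
    secCoord β.toBaseChart e a L s.base (D.along s) =
      iterTotalD L (fun p => G a (trunc q p)) (prolong (β.components s.toFun) (β.u s.base)) := by
  rw [← (hG.isSmoothOn a).iterD_prolong hG.isOpen L (LocalSection.components_smooth hs) hO]
  refine (foldr_congr L.toList ?_).eq_of_nhds
  filter_upwards [hG.along_eventuallyEq hs he hO] with p hp
  exact hp a

variable {D} in
-- The right side does not mention `s`: since `d_Λ E^a` has order at most `q + k`, every
-- representative of the `(q + k)`-jet of `z` gives the same derivatives.
theorem IsLocalRep.secCoord_along_infJet (hG : D.IsLocalRep β e O G) {z : InfJet n m pr}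
    (hz : InDomain β e z) (hO : trunc q (z.coord β) ∈ O) {k : ℕ}
    (hs : z.1 (q + k) = Jet.mk (q + k) s) (a : Fin l) {L : MultiIndex n}
    (hL : Multiset.card L ≤ k) :
    secCoord β.toBaseChart e a L z.base (D.along s) =
      iterTotalD L (fun p => G a (trunc q p)) (z.coord β) := by
  have hv := hz.value_mem
  have hb := hz.frame_mem
  have hq : trunc q (z.coord β) = trunc q (prolong (β.components s.toFun) (β.u s.base)) :=
    InfJet.trunc_coord (InfJet.eq_mk_of_le hs (Nat.le_add_right q k)) hv
  have h := InfJet.trunc_coord hs hv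
  rw [InfJet.value_eq hs] at hv
  rw [InfJet.base_eq hs] at hb ⊢
  rw [hG.secCoord_along hv hb (hq ▸ hO)]
  exact (((hG.isSmoothOn a).iterTotalD hG.isOpen L hL).congr (p := z.coord β) hO h).symm

variable {V : Type*} [TopologicalSpace V] [ChartedSpace (Euc m) V] [IsManifold (𝓡 m) ∞ V]
  (hpr : IsSmoothFiberBundle n m V pr)

include hpr

theorem along_mem_secE (s : LocalSection n m pr) : D.along s ∈ SecE n l E s.base := by
  obtain ⟨β, hβ, hs⟩ := hpr.exists_bundleChart (BaseChart.atPoint s.base) (y := s.toFun s.base)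
    (by rw [s.pr_value]; exact mem_chart_source _ _)
  have he := FrameChart.mem_atPoint (n := n) (l := l) (E := E) s.base
  obtain ⟨O, G, hG, hO⟩ := D.exists_isLocalRep (j := Jet.mk q s) hs he
  rw [Jet.coord_mk hs] at hO
  have hcont : Filter.Tendsto β.u (𝓝 s.base) (𝓝 (β.u s.base)) :=
    β.u.continuousAt (LocalSection.base_mem hs)
  have h1 := hcont.eventually (hG.along_eventuallyEq hs he hO)
  have h2 := β.u.open_source.mem_nhds (LocalSection.base_mem hs)
  -- Smoothness of a section is checked on its fiber component in a trivialization, here a composite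
  -- of the base chart, the prolongation and `G`.
  have h3 : ∀ᶠ x in 𝓝 s.base, (trivializationAt (Euc l) E s.base ⟨x, D.along s x⟩).2 =
      WithLp.toLp 2 fun a => G a (trunc q (prolong (β.components s.toFun) (β.u x))) := by
    filter_upwards [h1, h2] with x hx hx2
    rw [β.u.left_inv hx2] at hx
    ext a
    exact hx a
  have h4 : ∀ᶠ p in 𝓝 (β.u s.base), ContDiffAt ℝ ∞ (fun p => WithLp.toLp 2 fun a =>
      G a (trunc q (prolong (β.components s.toFun) p))) p := by
    filter_upwards [Filter.eventually_all.2 fun j =>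
        (LocalSection.components_smooth hs j).eventually_nhds,
      (prolong_contDiffAt (LocalSection.components_smooth hs) q).continuousAt.eventually
        (hG.isOpen.mem_nhds hO)] with p hp hp2
    refine (PiLp.contDiff_toLp (p := 2)).contDiffAt.comp p (contDiffAt_pi.2 fun a => ?_)
    exact ((hG.smooth a).contDiffAt (hG.isOpen.mem_nhds hp2)).comp p (prolong_contDiffAt hp q)
  filter_upwards [h3.eventually_nhds, h2, hcont.eventually h4,
    (trivializationAt (Euc l) E s.base).open_baseSet.mem_nhds he] with x hx hx2 hx3 hx4
  rw [(trivializationAt (Euc l) E s.base).contMDiffAt_section_iff hx4]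
  refine ContMDiffAt.congr_of_eventuallyEq ?_ hx
  exact ContMDiffAt.comp (g := fun p => WithLp.toLp 2 fun a =>
      G a (trunc q (prolong (β.components s.toFun) p))) x hx3.contMDiffAt
    (β.smooth.contMDiffAt (β.u.open_source.mem_nhds hx2))

/-- The germ of the section `x ↦ D (j^q_x s)` for a section `s` that represents the `(q + k)`-jet
of `z`. -/
def germ (z : InfJet n m pr) (k : ℕ) : SecE n l E z.base :=
  ⟨D.along (z.1 (q + k)).rep, by
    rw [InfJet.base_eq (z.1 (q + k)).mk_rep.symm]
    exact D.along_mem_secE hpr _⟩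

/-- The two germs come from unrelated representatives, but their derivatives of order at most `k`
both equal the total derivatives of the components at `z`. -/
theorem factor_germ (z : InfJet n m pr) (k : ℕ) :
    Submodule.factor (jetVanish_succ_le z.base k) (Submodule.Quotient.mk (D.germ hpr z (k + 1))) =
      Submodule.Quotient.mk (D.germ hpr z k) := by
  change Submodule.Quotient.mk (D.germ hpr z (k + 1)) = _
  rw [Submodule.Quotient.eq, jetVanish]
  simp only [Submodule.mem_iInf, LinearMap.mem_ker]
  intro u e hu he a L
  obtain ⟨β, rfl, hβ⟩ := hpr.exists_bundleChart u (y := z.value) (by rwa [z.pr_value])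
  obtain ⟨O, G, hG, hO⟩ := D.exists_isLocalRep (β := β) (e := e) (j := z.1 q)
    (by rwa [z.value_apply]) (by rwa [z.base_apply])
  rw [InfJet.coord_eq_trunc hβ] at hO
  rw [map_sub, sub_eq_zero]
  refine (hG.secCoord_along_infJet ⟨hβ, hu, he⟩ hO (z.1 (q + (k + 1))).mk_rep.symm a
    (L.2.trans k.le_succ)).trans ?_
  exact (hG.secCoord_along_infJet ⟨hβ, hu, he⟩ hO (z.1 (q + k)).mk_rep.symm a L.2).symm

/-- The infinite jet of the value of the operator at a point of `J^∞ Y`. -/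
def jetAlong (z : InfJet n m pr) : InfJetE n l E z.base :=
  ⟨fun k => Submodule.Quotient.mk (D.germ hpr z k), fun k => D.factor_germ hpr z k⟩

theorem fiberCoord_jetAlong {z : InfJet n m pr} (hz : InDomain β e z) (hG : D.IsLocalRep β e O G)
    (hO : trunc q (z.coord β) ∈ O) (a : Fin l) (L : MultiIndex n) :
    fiberCoord β.toBaseChart e a L z.base hz.base_mem hz.frame_mem (D.jetAlong hpr z) =
      iterTotalD L (fun p => G a (trunc q p)) (z.coord β) :=
  hG.secCoord_along_infJet hz hO (z.1 (q + Multiset.card L)).mk_rep.symm a le_rfl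

end DiffOp

end Operators

/-! ### Finite sums of homogeneous components -/

section Exterior

variable {M : Type*} [AddCommGroup M] [Module ℝ M]

theorem sum_component {N : ℕ} {x : ExteriorAlgebra ℝ M} (h : ∀ j, N < j → component j x = 0) :
    ∑ j ∈ Finset.range (N + 1), component j x = x := by
  classical
  conv_rhs => rw [← DirectSum.sum_support_decompose (fun i : ℕ => ⋀[ℝ]^i M) x]
  symm
  refine Finset.sum_subset (fun j hj => ?_) (fun j _ hj => ?_)
  · by_contra hN
    rw [Finset.mem_range] at hN
    rw [DFinsupp.mem_support_iff] at hj
    exact hj (Subtype.ext (h j (by omega)))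
  · rw [DFinsupp.notMem_support_iff] at hj
    exact congrArg Subtype.val hj

end Exterior

/-! ### Gradings from projections, and complexes from square-zero maps -/

section Abstract

variable {O S : Type*} [CommRing O] [Ring S] [Algebra O S]

theorem nonempty_gradedAlgebra_of_parts (A : ℕ → Submodule O S) [SetLike.GradedMonoid A]
    (part : ℕ → S →ₗ[O] S) (mem : ∀ j F, part j F ∈ A j)
    (part_of_mem : ∀ i j F, F ∈ A i → part j F = if i = j then F else 0)
    (sum_part : ∀ F, ∃ N, ∑ j ∈ Finset.range (N + 1), part j F = F) :
    Nonempty (GradedAlgebra A) := by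
  -- The parts recover the summands of a finite sum, which gives injectivity; surjectivity is
  -- `sum_part`.
  have key : ∀ (x : DirectSum ℕ fun i => A i) (j : ℕ),
      part j (DirectSum.coeAddMonoidHom A x) = x j := by
    intro x j
    induction x using DirectSum.induction_on with
    | zero => simp
    | of i F =>
      rw [DirectSum.coeAddMonoidHom_of, part_of_mem i j _ F.2]
      split_ifs with h
      · subst h
        rw [DirectSum.of_eq_same]
      · rw [DirectSum.of_eq_of_ne _ _ _ (Ne.symm h)]
        rfl
    | add x y hx hy => rw [map_add, map_add, hx, hy, DirectSum.add_apply, Submodule.coe_add]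
  have hA : DirectSum.IsInternal A := by
    constructor
    · intro x y h
      exact DFinsupp.ext fun j => Subtype.ext (by rw [← key, ← key, h])
    · intro F
      obtain ⟨N, hN⟩ := sum_part F
      refine ⟨∑ j ∈ Finset.range (N + 1), DirectSum.of (fun i => A i) j ⟨part j F, mem j F⟩, ?_⟩
      simpa only [map_sum, DirectSum.coeAddMonoidHom_of] using hN
  exact ⟨{ (inferInstance : SetLike.GradedMonoid A), hA.chooseDecomposition with }⟩

theorem exists_isComplexOf (A : ℕ → Submodule O S) (δ : S →ₗ[O] S)
    (mem : ∀ k, ∀ F ∈ A (k + 1), δ F ∈ A k) (sq : ∀ F, δ (δ F) = 0) :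
    ∃ C : ChainComplex (ModuleCat O) ℕ, IsComplexOf A δ C := by
  let d : ∀ k, ModuleCat.of O (A (k + 1)) ⟶ ModuleCat.of O (A k) :=
    fun k => ModuleCat.ofHom (δ.restrict (mem k))
  have hd : ∀ k, d (k + 1) ≫ d k = 0 := fun k => by
    ext F
    exact sq F.1
  refine ⟨ChainComplex.of _ d hd, fun k => Iso.refl _, fun k => ?_⟩
  have h : (ChainComplex.of (fun k => ModuleCat.of O (A k)) d hd).d (k + 1) k = d k :=
    ChainComplex.of_d (fun k => ModuleCat.of O (A k)) d k
  rw [h]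
  rfl

end Abstract

/-! ### The graded ring of graded functions -/

section Graded

set_option linter.unusedSectionVars false

variable {n m l : ℕ}
  {X : Type*} [TopologicalSpace X] [ChartedSpace (Euc n) X]
  {E : X → Type*} [∀ x, AddCommGroup (E x)] [∀ x, Module ℝ (E x)]
  [TopologicalSpace (TotalSpace (Euc l) E)] [∀ x, TopologicalSpace (E x)]
  [FiberBundle (Euc l) E] [VectorBundle ℝ (Euc l) E] [IsManifold (𝓡 n) ∞ X]
  [ContMDiffVectorBundle ∞ (Euc l) E (𝓡 n)]
  {Y : Type*} [TopologicalSpace Y] [ChartedSpace (ModelProd (Euc n) (Euc m)) Y]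
  {pr : Y → X}
  {V : Type*} [TopologicalSpace V] [ChartedSpace (Euc m) V] [IsManifold (𝓡 m) ∞ V]

/-- The linear forms whose images in the Grassmann algebra are the odd elements. -/
def fiberCoords {β : BundleChart n m pr} {e : FrameChart n l E} {z : InfJet n m pr}
    (hz : InDomain β e z) (p : Fin l × MultiIndex n) : Module.Dual ℝ (InfJetE n l E z.base) :=
  fiberCoord β.toBaseChart e p.1 p.2 z.base hz.base_mem hz.frame_mem

theorem prod_oddCoord {β : BundleChart n m pr} {e : FrameChart n l E} {z : InfJet n m pr}
    (hz : InDomain β e z) (w : List (Fin l × MultiIndex n)) :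
    (w.map (oddCoord β e hz)).prod = monomial (fiberCoords hz) w := rfl

theorem exists_inDomain (hpr : IsSmoothFiberBundle n m V pr) (z : InfJet n m pr) :
    ∃ (β : BundleChart n m pr) (e : FrameChart n l E), InDomain β e z := by
  have hx : z.base ∈ (BaseChart.atPoint (n := n) z.base).u.source := mem_chart_source _ _
  obtain ⟨β, hβ, hz⟩ := hpr.exists_bundleChart (BaseChart.atPoint z.base) (y := z.value)
    (by rwa [z.pr_value])
  exact ⟨β, FrameChart.atPoint n l E z.base, hz, hβ ▸ hx, FrameChart.mem_atPoint _⟩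

variable (n l E) in
/-- The projection of the Grassmann algebra at a point onto its elements of degree `j`. -/
def degreePart (j : ℕ) (z : InfJet n m pr) : Grassmann n l E z →ₗ[ℝ] Grassmann n l E z :=
  component j

theorem degreePart_mem (j : ℕ) (z : InfJet n m pr) (x : Grassmann n l E z) :
    degreePart n l E j z x ∈ ⋀[ℝ]^j (Module.Dual ℝ (InfJetE n l E (InfJet.base z))) :=
  component_mem j x

theorem degreePart_of_mem (j : ℕ) (z : InfJet n m pr) (i : ℕ) (x : Grassmann n l E z)
    (hx : x ∈ ⋀[ℝ]^i (Module.Dual ℝ (InfJetE n l E (InfJet.base z)))) :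
    degreePart n l E j z x = if i = j then x else 0 :=
  component_of_mem hx

theorem sum_degreePart {N : ℕ} {z : InfJet n m pr} {x : Grassmann n l E z}
    (h : ∀ j, N < j → degreePart n l E j z x = 0) :
    ∑ j ∈ Finset.range (N + 1), degreePart n l E j z x = x :=
  sum_component h

namespace IsGradedFunction

variable {r k : ℕ} {F : ∀ z : InfJet n m pr, Grassmann n l E z}

theorem degreePart (hF : IsGradedFunction r k F) (j : ℕ) :
    IsGradedFunction r k (fun z => degreePart n l E j z (F z)) := by
  intro β e z₀ hz₀
  obtain ⟨O, I, _, w, G, hO, hz, hG, hFG⟩ := hF β e z₀ hz₀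
  -- Each monomial is homogeneous of degree the length of its word; words of other lengths get
  -- coefficient zero.
  refine ⟨O, I, inferInstance, w, fun i => if (w i).length = j then G i else 0, hO, hz,
    fun i => ⟨?_, (hG i).2⟩, fun z h1 h2 => ?_⟩
  · beta_reduce
    split_ifs
    · exact (hG i).1
    · exact contDiffOn_const
  · beta_reduce
    rw [hFG z h1 h2, map_sum]
    refine Finset.sum_congr rfl fun i _ => ?_
    rw [map_smul, prod_oddCoord, degreePart_of_mem _ _ _ _ (monomial_mem _ _)]
    split_ifs <;> simp

/-- There are only finitely many odd elements of bounded jet order. -/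
theorem degreePart_eq_zero (hpr : IsSmoothFiberBundle n m V pr) (hF : IsGradedFunction r k F)
    {j : ℕ} (hj : Fintype.card (Fin l × MultiIndexLE n k) < j) (z : InfJet n m pr) :
    KoszulTate.degreePart n l E j z (F z) = 0 := by
  classical
  obtain ⟨β, e, hz⟩ := exists_inDomain (l := l) (E := E) hpr z
  obtain ⟨O, I, _, w, G, hO, hzO, hG, hFG⟩ := hF β e z hz
  rw [hFG z hz hzO, map_sum]
  refine Finset.sum_eq_zero fun i _ => ?_
  rw [map_smul, prod_oddCoord, degreePart_of_mem _ _ _ _ (monomial_mem _ _)]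
  split_ifs with h
  -- A word longer than the number of available letters repeats one, so its monomial vanishes.
  · rw [monomial_eq_zero, smul_zero]
    intro hnd
    let S : Finset (Fin l × MultiIndex n) :=
      Finset.univ.image fun p : Fin l × MultiIndexLE n k => (p.1, p.2.1)
    have hS : (w i).toFinset ⊆ S := fun p hp => Finset.mem_image.2
      ⟨(p.1, ⟨p.2, (hG i).2 p (List.mem_toFinset.1 hp)⟩), Finset.mem_univ _, rfl⟩
    have h1 := Finset.card_le_card hS
    rw [List.toFinset_card_of_nodup hnd] at h1
    have h2 : S.card ≤ _ := Finset.card_image_le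
    rw [Finset.card_univ] at h2
    omega
  · exact smul_zero _

/-- The scalar part is the sum of the coefficients of the empty words. This identifies degree zero
with the smooth functions. -/
theorem isSmoothFunction_algebraMapInv (hF : IsGradedFunction r k F) :
    IsSmoothFunction r (fun z => ExteriorAlgebra.algebraMapInv (F z)) := by
  classical
  intro β z₀ hz₀
  have hb : ∀ z : InfJet n m pr, z.value ∈ β.v.source → z.base ∈ β.u.source := fun z hz =>
    z.pr_value ▸ β.proj_mem _ hz
  let e := FrameChart.atPoint n l E z₀.base
  have he : z₀.base ∈ e.e.baseSet := FrameChart.mem_atPoint _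
  obtain ⟨O, I, _, w, G, hO, hz, hG, hFG⟩ := hF β e z₀ ⟨hz₀, hb _ hz₀, he⟩
  have hU : IsOpen (β.u.target ∩ β.u.symm ⁻¹' e.e.baseSet) :=
    β.u.symm.isOpen_inter_preimage e.e.open_baseSet
  -- Smooth functions are tested on the whole bundle chart, so the open set is cut down to points
  -- over the domain of the frame `e`.
  refine ⟨O ∩ Prod.fst ⁻¹' (β.u.target ∩ β.u.symm ⁻¹' e.e.baseSet),
    fun p => ∑ i, if w i = [] then G i p else 0, hO.inter (hU.preimage continuous_fst),
    ⟨hz, β.u.map_source (hb _ hz₀), ?_⟩, ?_, fun z h1 h2 => ?_⟩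
  · change β.u.symm (β.u z₀.base) ∈ e.e.baseSet
    rwa [β.u.left_inv (hb _ hz₀)]
  · refine ContDiffOn.sum fun i _ => ?_
    split_ifs
    · exact (hG i).1.mono Set.inter_subset_left
    · exact contDiffOn_const
  · have h3 : β.u.symm (β.u z.base) ∈ e.e.baseSet := h2.2.2
    rw [β.u.left_inv (hb _ h1)] at h3
    beta_reduce
    rw [hFG z ⟨h1, hb _ h1, h3⟩ h2.1, map_sum]
    refine Finset.sum_congr rfl fun i _ => ?_
    rw [map_smul, prod_oddCoord, algebraMapInv_monomial]
    split_ifs <;> simp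

end IsGradedFunction

theorem smul_apply (f : OInf n m pr) (F : SInf n m l E pr) (z : InfJet n m pr) :
    (f • F).1 z = f.1 z • F.1 z := by
  rw [Algebra.smul_def, Algebra.smul_def]
  rfl

theorem algebraMap_apply (f : OInf n m pr) (z : InfJet n m pr) :
    (algebraMap (OInf n m pr) (SInf n m l E pr) f).1 z = algebraMap ℝ _ (f.1 z) := rfl

theorem algebraMap_injective :
    Function.Injective (algebraMap (OInf n m pr) (SInf n m l E pr)) := by
  intro f g h
  refine Subtype.ext (funext fun z => ?_)
  have h1 := congrFun (congrArg Subtype.val h) z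
  rw [algebraMap_apply, algebraMap_apply] at h1
  exact (ExteriorAlgebra.algebraMap_inj _ _ _).1 h1

theorem SDeg_zero : SDeg n m l E pr 0 =
    LinearMap.range (Algebra.linearMap (OInf n m pr) (SInf n m l E pr)) := by
  ext F
  constructor
  · intro hF
    obtain ⟨r, hr⟩ := F.2
    refine ⟨⟨fun z => ExteriorAlgebra.algebraMapInv (F.1 z), r,
      hr.isSmoothFunction_algebraMapInv⟩, ?_⟩
    exact Subtype.ext (funext fun z => algebraMap_algebraMapInv (hF z))
  · rintro ⟨f, rfl⟩ z
    exact SetLike.algebraMap_mem_graded (fun i : ℕ => ⋀[ℝ]^i (Module.Dual ℝ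
      (InfJetE n l E (InfJet.base z)))) (f.1 z)

instance : SetLike.GradedMonoid (SDeg n m l E pr) where
  one_mem z := SetLike.GradedOne.one_mem (A := fun i : ℕ => ⋀[ℝ]^i (Module.Dual ℝ
    (InfJetE n l E (InfJet.base z))))
  mul_mem _ _ _ _ hF hF' z := SetLike.GradedMul.mul_mem (A := fun i : ℕ => ⋀[ℝ]^i (Module.Dual ℝ
    (InfJetE n l E (InfJet.base z)))) (hF z) (hF' z)

/-- The operator on graded functions that acts pointwise by linear operators. -/
def pointwiseMap (T : ∀ z : InfJet n m pr, Grassmann n l E z →ₗ[ℝ] Grassmann n l E z)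
    (hT : ∀ F ∈ SInf n m l E pr, (fun z => T z (F z)) ∈ SInf n m l E pr) :
    SInf n m l E pr →ₗ[OInf n m pr] SInf n m l E pr where
  toFun F := ⟨fun z => T z (F.1 z), hT F.1 F.2⟩
  map_add' F F' := Subtype.ext (funext fun z => map_add (T z) (F.1 z) (F'.1 z))
  map_smul' f F := Subtype.ext (funext fun z => by
    simp only [RingHom.id_apply, smul_apply, map_smul])

theorem pointwiseMap_eq {T : ∀ z : InfJet n m pr, Grassmann n l E z →ₗ[ℝ] Grassmann n l E z}
    {hT : ∀ F ∈ SInf n m l E pr, (fun z => T z (F z)) ∈ SInf n m l E pr} {F F' : SInf n m l E pr}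
    (h : ∀ z, T z (F.1 z) = F'.1 z) : pointwiseMap T hT F = F' :=
  Subtype.ext (funext h)

variable (n m l E pr) in
/-- The homogeneous component of a graded function. -/
def homogeneousPart (j : ℕ) : SInf n m l E pr →ₗ[OInf n m pr] SInf n m l E pr :=
  pointwiseMap (degreePart n l E j) fun _ hF => hF.imp fun _ h => h.degreePart j

theorem homogeneousPart_mem (j : ℕ) (F : SInf n m l E pr) :
    homogeneousPart n m l E pr j F ∈ SDeg n m l E pr j :=
  fun z => degreePart_mem j z _

theorem homogeneousPart_of_mem (i j : ℕ) (F : SInf n m l E pr) (hF : F ∈ SDeg n m l E pr i) :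
    homogeneousPart n m l E pr j F = if i = j then F else 0 := by
  split_ifs with h
  · exact pointwiseMap_eq fun z => (degreePart_of_mem j z i _ (hF z)).trans (if_pos h)
  · exact pointwiseMap_eq fun z => (degreePart_of_mem j z i _ (hF z)).trans (if_neg h)

/-- The jet order of `F` bounds its degree uniformly in `z`, so one finite sum works globally. -/
theorem sum_homogeneousPart (hpr : IsSmoothFiberBundle n m V pr) (F : SInf n m l E pr) :
    ∃ N, ∑ j ∈ Finset.range (N + 1), homogeneousPart n m l E pr j F = F := by
  obtain ⟨r, hr⟩ := F.2
  refine ⟨Fintype.card (Fin l × MultiIndexLE n r), Subtype.ext (funext fun z => ?_)⟩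
  rw [AddSubmonoidClass.coe_finsetSum, Finset.sum_apply]
  exact sum_degreePart fun j hj => hr.degreePart_eq_zero hpr hj z

theorem nonempty_gradedAlgebra_SDeg (hpr : IsSmoothFiberBundle n m V pr) :
    Nonempty (GradedAlgebra (SDeg n m l E pr)) :=
  nonempty_gradedAlgebra_of_parts _ (homogeneousPart n m l E pr) homogeneousPart_mem
    homogeneousPart_of_mem (sum_homogeneousPart hpr)

/-! ### The Koszul-Tate differential -/

namespace DiffOp

variable {q : ℕ} (D : DiffOp n m l E pr q)

theorem exists_isLocalRep_infJet {β : BundleChart n m pr} {e : FrameChart n l E}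
    {z : InfJet n m pr} (hz : InDomain β e z) :
    ∃ O G, D.IsLocalRep β e O G ∧ trunc q (z.coord β) ∈ O := by
  rw [← InfJet.coord_eq_trunc hz.value_mem]
  exact D.exists_isLocalRep (by rw [z.value_apply]; exact hz.value_mem)
    (by rw [z.base_apply]; exact hz.frame_mem)

variable {D} in
theorem IsKoszulTateAt.map_monomial {z : InfJet n m pr}
    {d : Grassmann n l E z →ₗ[ℝ] Grassmann n l E z} (hd : D.IsKoszulTateAt z d)
    {β : BundleChart n m pr} {e : FrameChart n l E} (hz : InDomain β e z)
    {O : Set (FinCoord n m q)} {G : Fin l → FinCoord n m q → ℝ} (hG : D.IsLocalRep β e O G)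
    (hO : trunc q (z.coord β) ∈ O) (w : List (Fin l × MultiIndex n)) :
    d (monomial (fiberCoords hz) w) = ∑ i : Fin w.length, ((-1) ^ (w.length - 1 - i) *
      iterTotalD (w.get i).2 (fun p => G (w.get i).1 (trunc q p)) (z.coord β)) •
        monomial (fiberCoords hz) (w.eraseIdx i) :=
  IsRightAntiderivation.map_monomial hd.mul
    (c := fun p => iterTotalD p.2 (fun x => G p.1 (trunc q x)) (z.coord β))
    (fun p => hd.odd β e hz O G hG hO p.1 p.2) w

variable {D} in
-- Both maps agree on monomials in the `c^a_Λ`. They are compared only at values of graded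
-- functions, since these forms need not span the full algebraic dual of `J^∞_x E`.
theorem IsKoszulTateAt.eq_on (hpr : IsSmoothFiberBundle n m V pr) {z : InfJet n m pr}
    {d d' : Grassmann n l E z →ₗ[ℝ] Grassmann n l E z} (hd : D.IsKoszulTateAt z d)
    (hd' : D.IsKoszulTateAt z d') {r k : ℕ} {F : ∀ z : InfJet n m pr, Grassmann n l E z}
    (hF : IsGradedFunction r k F) : d (F z) = d' (F z) := by
  obtain ⟨β, e, hz⟩ := exists_inDomain (l := l) (E := E) hpr z
  obtain ⟨O, G, hG, hO⟩ := D.exists_isLocalRep_infJet hz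
  obtain ⟨O', I, _, w, G', -, hzO, -, hFG⟩ := hF β e z hz
  simp only [hFG z hz hzO, map_sum, map_smul, prod_oddCoord, hd.map_monomial hz hG hO,
    hd'.map_monomial hz hG hO]

variable {D} in
-- Each term of the monomial expansion carries a factor `d_Λ E^a` with `|Λ| ≤ k`, a derivative at
-- the base point of a section with zero `k`-jet.
theorem IsKoszulTateAt.eq_zero_of_mem_prolongedKer (hpr : IsSmoothFiberBundle n m V pr)
    {z : InfJet n m pr} {d : Grassmann n l E z →ₗ[ℝ] Grassmann n l E z}
    (hd : D.IsKoszulTateAt z d) {r k : ℕ} {F : ∀ z : InfJet n m pr, Grassmann n l E z}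
    (hF : IsGradedFunction r k F) (hzk : z ∈ D.prolongedKer k) : d (F z) = 0 := by
  obtain ⟨β, e, hz⟩ := exists_inDomain (l := l) (E := E) hpr z
  obtain ⟨O, G, hG, hO⟩ := D.exists_isLocalRep_infJet hz
  obtain ⟨O', I, _, w, G', -, hzO, hw, hFG⟩ := hF β e z hz
  obtain ⟨s, hs, h0⟩ := hzk
  have hb := InfJet.base_eq hs.symm
  simp only [hFG z hz hzO, map_sum, map_smul, prod_oddCoord, hd.map_monomial hz hG hO]
  refine Finset.sum_eq_zero fun i _ => ?_
  rw [Finset.sum_eq_zero, smul_zero]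
  intro j _
  have hL := (hw i).2 _ (List.get_mem (w i) j)
  have h1 := hG.secCoord_along_infJet hz hO hs.symm ((w i).get j).1 hL
  rw [hb, h0 _ _ (hb ▸ hz.base_mem) (hb ▸ hz.frame_mem) _ _ hL] at h1
  rw [← h1, mul_zero, zero_smul]

theorem mk_mem_prolongedKer {s : LocalSection n m pr} (hs : D.IsSolution s) (k : ℕ) :
    InfJet.mk s ∈ D.prolongedKer k := by
  refine ⟨s, rfl, fun u e hu he a L _ => ?_⟩
  have h0 : Filter.Tendsto u.u.symm (𝓝 (u.u s.base)) (𝓝 s.base) := by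
    have := u.u.continuousAt_symm (u.u.map_source hu)
    rwa [ContinuousAt, u.u.left_inv hu] at this
  -- The zero germ is written as `0 • 0`, so that homogeneity of iterated derivatives makes them
  -- vanish.
  have h1 : (fun p => (e.e ⟨u.u.symm p, D.along s (u.u.symm p)⟩).2 a) =ᶠ[𝓝 (u.u s.base)]
      (0 : ℝ) • (0 : Euc n → ℝ) := by
    filter_upwards [h0.eventually hs, h0.eventually s.isLocalSection.eventually_nhds,
      symm_mem_baseSet u e hu he] with p hp hp2 hp3
    have h2 : D.along s (u.u.symm p) = 0 := by
      rw [D.along_of_isLocalSection hp2]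
      exact hp hp2
    have h3 : (e.e (TotalSpace.mk' (Euc l) (u.u.symm p) 0)).2 = 0 :=
      (e.isLinear.linear _ hp3).map_zero
    rw [h2]
    change (e.e (TotalSpace.mk' (Euc l) (u.u.symm p) 0)).2 a = _
    rw [h3]
    simp
  refine ((foldr_congr L.toList h1).trans
    (foldr_smul L.toList 0 (.of_forall fun _ => contDiffAt_const))).eq_of_nhds.trans ?_
  simp

variable (hpr : IsSmoothFiberBundle n m V pr)

/-- The value of the Koszul-Tate differential at a point: the contraction with the jet of the
value of the operator. -/
def contraction (z : InfJet n m pr) : Grassmann n l E z →ₗ[ℝ] Grassmann n l E z :=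
  contract (Module.Dual.eval ℝ _ (D.jetAlong hpr z))

theorem isKoszulTateAt_contraction (z : InfJet n m pr) :
    D.IsKoszulTateAt z (D.contraction hpr z) where
  mul := contract_isRightAntiderivation _
  odd β e hz O G hG hO a L := by
    rw [← D.fiberCoord_jetAlong hpr hz hG hO a L]
    exact contract_ι _ _

/-- Deleting letters cannot raise the odd jet order `k`; the new coefficients `d_Λ E^a`, `|Λ| ≤ k`,
have order at most `q + k`. -/
theorem isGradedFunction_contraction {r k : ℕ} {F : ∀ z : InfJet n m pr, Grassmann n l E z}
    (hF : IsGradedFunction r k F) :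
    IsGradedFunction (max r (q + k)) k (fun z => D.contraction hpr z (F z)) := by
  intro β e z₀ hz₀
  obtain ⟨O, I, _, w, G, hO, hz, hG, hFG⟩ := hF β e z₀ hz₀
  obtain ⟨O', G', hG', hO'⟩ := D.exists_isLocalRep_infJet hz₀
  -- The bound on `|Λ|` sits inside the statement so that one choice covers all letters; for longer
  -- `Λ` the function is irrelevant and set to zero.
  have h : ∀ p : Fin l × MultiIndex n, ∃ H : FinCoord n m (q + k) → ℝ, Multiset.card p.2 ≤ k →
      ContDiffOn ℝ ∞ H (restr (Nat.le_add_right q k) ⁻¹' O') ∧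
      ∀ x : InfCoord n m, trunc q x ∈ O' →
        iterTotalD p.2 (fun x => G' p.1 (trunc q x)) x = H (trunc (q + k) x) := by
    intro p
    by_cases hp : Multiset.card p.2 ≤ k
    · obtain ⟨H, h1, h2⟩ := (hG'.isSmoothOn p.1).iterTotalD hG'.isOpen p.2 hp
      exact ⟨H, fun _ => ⟨h1, h2⟩⟩
    · exact ⟨0, fun h => absurd h hp⟩
  choose H hH using h
  have hr : r ≤ max r (q + k) := le_max_left _ _
  have hqk : q + k ≤ max r (q + k) := le_max_right _ _
  refine ⟨restr hr ⁻¹' O ∩ restr hqk ⁻¹' (restr (Nat.le_add_right q k) ⁻¹' O'),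
    -- The new monomials are indexed by an old word together with the position deleted from it.
    Σ i : I, Fin (w i).length, inferInstance, fun i => (w i.1).eraseIdx i.2,
    fun i p => G i.1 (restr hr p) *
      ((-1) ^ ((w i.1).length - 1 - i.2) * H ((w i.1).get i.2) (restr hqk p)), ?_, ⟨hz, hO'⟩,
    fun i => ⟨?_, fun p hp => (hG i.1).2 p (List.eraseIdx_subset hp)⟩, fun z h1 h2 => ?_⟩
  · exact (hO.preimage (restr hr).continuous).inter
      ((hG'.isOpen.preimage (restr _).continuous).preimage (restr _).continuous)
  · have hp := (hG i.1).2 _ (List.get_mem (w i.1) i.2)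
    refine ContDiffOn.mul ((hG i.1).1.comp (restr hr).contDiff.contDiffOn fun _ hx => hx.1)
      (contDiffOn_const.mul ?_)
    exact (hH _ hp).1.comp (restr hqk).contDiff.contDiffOn fun _ hx => hx.2
  · beta_reduce
    rw [hFG z h1 h2.1, map_sum, Fintype.sum_sigma]
    refine Finset.sum_congr rfl fun i _ => ?_
    rw [map_smul, prod_oddCoord,
      (D.isKoszulTateAt_contraction hpr z).map_monomial h1 hG' h2.2, Finset.smul_sum]
    refine Finset.sum_congr rfl fun j _ => ?_
    rw [smul_smul, prod_oddCoord, (hH _ ((hG i).2 _ (List.get_mem (w i) j))).2 _ h2.2]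
    rfl

/-- The Koszul-Tate differential. -/
def delta : SInf n m l E pr →ₗ[OInf n m pr] SInf n m l E pr :=
  pointwiseMap (D.contraction hpr) fun _ ⟨_, hr⟩ =>
    -- Membership in the ring asks for equal orders, so the odd order is raised to that of the
    -- coefficients.
    ⟨_, (D.isGradedFunction_contraction hpr hr).mono le_rfl (le_max_left _ _)⟩

theorem exists_isKoszulTateAt_delta (z : InfJet n m pr) :
    ∃ d, D.IsKoszulTateAt z d ∧ ∀ F : SInf n m l E pr, (D.delta hpr F).1 z = d (F.1 z) :=
  ⟨_, D.isKoszulTateAt_contraction hpr z, fun _ => rfl⟩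

theorem eq_delta (δ : SInf n m l E pr →ₗ[OInf n m pr] SInf n m l E pr)
    (hδ : ∀ z, ∃ d, D.IsKoszulTateAt z d ∧ ∀ F, (δ F).1 z = d (F.1 z)) : δ = D.delta hpr := by
  refine LinearMap.ext fun F => (pointwiseMap_eq fun z => ?_).symm
  obtain ⟨d, hd, hF⟩ := hδ z
  obtain ⟨r, hr⟩ := F.2
  exact ((D.isKoszulTateAt_contraction hpr z).eq_on hpr hd hr).trans (hF F).symm

theorem delta_eq_zero_of_mem_prolongedKer (r k : ℕ) (F : SInf n m l E pr)
    (hF : IsGradedFunction r k F.1) (z : InfJet n m pr) (hz : z ∈ D.prolongedKer k) :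
    (D.delta hpr F).1 z = 0 :=
  (D.isKoszulTateAt_contraction hpr z).eq_zero_of_mem_prolongedKer hpr hF hz

theorem delta_eq_zero_of_isSolution (s : LocalSection n m pr) (hs : D.IsSolution s)
    (F : SInf n m l E pr) : (D.delta hpr F).1 (InfJet.mk s) = 0 := by
  obtain ⟨r, hr⟩ := F.2
  exact D.delta_eq_zero_of_mem_prolongedKer hpr r r F hr _ (D.mk_mem_prolongedKer hs r)

theorem delta_delta (F : SInf n m l E pr) : D.delta hpr (D.delta hpr F) = 0 :=
  Subtype.ext (funext fun _ => contract_contract _ _)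

theorem delta_algebraMap (f : OInf n m pr) : D.delta hpr (algebraMap _ _ f) = 0 :=
  Subtype.ext (funext fun _ => contract_algebraMap _ _)

theorem delta_mul (F F' : SInf n m l E pr) (k : ℕ) (hF' : F' ∈ SDeg n m l E pr k) :
    D.delta hpr (F * F') = (-1) ^ k * (D.delta hpr F * F') + F * D.delta hpr F' := by
  refine Subtype.ext (funext fun z => ?_)
  refine (contract_isRightAntiderivation _ (F.1 z) (F'.1 z) k (hF' z)).trans ?_
  change _ = (-1) ^ k * (D.contraction hpr z (F.1 z) * F'.1 z) + F.1 z * D.contraction hpr z (F'.1 z)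
  congr 1
  -- The sign is a real scalar in the pointwise rule and a ring element in the statement.
  rw [Algebra.smul_def, map_pow, map_neg, map_one]
  rfl

theorem delta_mem (k : ℕ) (F : SInf n m l E pr) (hF : F ∈ SDeg n m l E pr (k + 1)) :
    D.delta hpr F ∈ SDeg n m l E pr k :=
  fun z => contract_mem _ (hF z)

end DiffOp

end Graded

end KoszulTate

theorem proposition2 {n m l : ℕ}
    {X : Type*} [TopologicalSpace X] [ChartedSpace (KoszulTate.Euc n) X] [IsManifold (𝓡 n) ∞ X]
    {Y : Type*} [TopologicalSpace Y]
    [ChartedSpace (ModelProd (KoszulTate.Euc n) (KoszulTate.Euc m)) Y]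
    [IsManifold ((𝓡 n).prod (𝓡 m)) ∞ Y]
    {V : Type*} [TopologicalSpace V] [ChartedSpace (KoszulTate.Euc m) V] [IsManifold (𝓡 m) ∞ V]
    (pr : Y → X) (hpr : KoszulTate.IsSmoothFiberBundle n m V pr)
    (E : X → Type*) [∀ x, AddCommGroup (E x)] [∀ x, Module ℝ (E x)]
    [TopologicalSpace (TotalSpace (KoszulTate.Euc l) E)] [∀ x, TopologicalSpace (E x)]
    [FiberBundle (KoszulTate.Euc l) E] [VectorBundle ℝ (KoszulTate.Euc l) E]
    [ContMDiffVectorBundle ∞ (KoszulTate.Euc l) E (𝓡 n)]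
    (q : ℕ) (D : KoszulTate.DiffOp n m l E pr q) :
    -- the ring is graded by the antifield number, with the smooth functions in degree zero
    Nonempty (GradedAlgebra (KoszulTate.SDeg n m l E pr)) ∧
    Function.Injective (algebraMap (KoszulTate.OInf n m pr) (KoszulTate.SInf n m l E pr)) ∧
    KoszulTate.SDeg n m l E pr 0 =
      LinearMap.range (Algebra.linearMap (KoszulTate.OInf n m pr) (KoszulTate.SInf n m l E pr)) ∧
    ∃ δ : KoszulTate.SInf n m l E pr →ₗ[KoszulTate.OInf n m pr] KoszulTate.SInf n m l E pr,
      -- `δ` is given in each local basis by `∂_a E^a` acting on the right, and is the only such map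
      (∀ z, ∃ d, D.IsKoszulTateAt z d ∧ ∀ F, (δ F).1 z = d (F.1 z)) ∧
      (∀ δ' : KoszulTate.SInf n m l E pr →ₗ[KoszulTate.OInf n m pr] KoszulTate.SInf n m l E pr,
        (∀ z, ∃ d, D.IsKoszulTateAt z d ∧ ∀ F, (δ' F).1 z = d (F.1 z)) → δ' = δ) ∧
      -- `δ` is a right graded derivation over the ring of smooth functions
      (∀ f : KoszulTate.OInf n m pr, δ (algebraMap _ _ f) = 0) ∧
      (∀ (F F' : KoszulTate.SInf n m l E pr) (k : ℕ), F' ∈ KoszulTate.SDeg n m l E pr k →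
        δ (F * F') = (-1) ^ k * (δ F * F') + F * δ F') ∧
      -- `δ` is nilpotent
      (∀ F, δ (δ F) = 0) ∧
      -- `δ` makes the ring a chain complex of modules over the ring of smooth functions
      (∃ C : ChainComplex (ModuleCat (KoszulTate.OInf n m pr)) ℕ,
        KoszulTate.IsComplexOf (KoszulTate.SDeg n m l E pr) δ C) ∧
      -- boundaries vanish on the (prolonged) kernel of the operator and along its solutions
      (∀ (r k : ℕ) (F : KoszulTate.SInf n m l E pr), KoszulTate.IsGradedFunction r k F.1 →
        ∀ z ∈ D.prolongedKer k, (δ F).1 z = 0) ∧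
      (∀ s : KoszulTate.LocalSection n m pr, D.IsSolution s →
        ∀ F : KoszulTate.SInf n m l E pr, (δ F).1 (KoszulTate.InfJet.mk s) = 0) := by
  exact ⟨KoszulTate.nonempty_gradedAlgebra_SDeg hpr, KoszulTate.algebraMap_injective,
    KoszulTate.SDeg_zero, D.delta hpr, D.exists_isKoszulTateAt_delta hpr, D.eq_delta hpr,
    D.delta_algebraMap hpr, D.delta_mul hpr, D.delta_delta hpr,
    KoszulTate.exists_isComplexOf _ _ (D.delta_mem hpr) (D.delta_delta hpr),
    D.delta_eq_zero_of_mem_prolongedKer hpr, D.delta_eq_zero_of_isSolution hpr⟩
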